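/- Let $x_0<x_1<\dots<x_N$ be a mesh of a bounded interval with elements $\Omega_k=[x_{k-1},x_k]$, $\mathcal T_h=\{\Omega_k\}_{k=1}^N$. Fix an integer $s\ge 0$ and $1\le p<\infty$, and let $V(\mathcal T_h)=W^{s,p}(\mathcal T_h)$ be the broken Sobolev space of complex-valued functions that belong to $L^p(\Omega_k)$ together with their weak derivatives of order at most $s$ on every element $\Omega_k$, with norm $\big(\sum_{k=1}^N\sum_{j=0}^s\|D^jv\|_{L^p(\Omega_k)}^p\big)^{1/p}$. Let $\sigma:\mathbb R\to\mathbb C$ be bounded, not almost everywhere equal to a constant, and elementwise smooth at least in the sense that every discontinuous network function $$v|_{\Omega_k}(x)=\sum_{j=1}^n c^{(k)}_j\,\sigma\big(W^{(k)}_jx+b^{(k)}_j\big),\qquad k=1,\dots,N,\qquad W_j^{(k)},b_j^{(k)}\in\mathbb R,\ c_j^{(k)}\in\mathbb C,$$ belongs to $V(\mathcal T_h)$ (this holds for instance if $\sigma\in C^s(\mathbb R)$). Let $(C_n)$ be a nondecreasing sequence of positive numbers with $C_n\to\infty$, and let $V^\sigma_{n,C_n}(\mathcal T_h)$ be the set of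 network functions of width $n$ having parameters $\Theta=[W,b,c]$ with $$\|\Theta\|=\max_k\Big(\max_j|W^{(k)}_j|+\max_j|b^{(k)}_j|+\max_j|c^{(k)}_j|\Big)<C_n .$$ Let $Y$ be a Hilbert space that is the orthogonal sum of its restrictions $Y_k=Y|_{\Omega_k}$ to the elements, let $\{\varphi_{k,i}\}_{i\ge1}$ be a complete orthonormal basis of $Y_k$ for each $k$, and let $Z$ and $\mathcal W$ be normed spaces. Let $\mathcal A:V(\mathcal T_h)\to Y$, $\mathcal B:V(\mathcal T_h)\to Z$ and the jump operators $v\mapsto[[C_1v]]$, $v\mapsto[[C_2v]]$, $V(\mathcal T_h)\to\mathcal W$, be bounded linear operators, let $f\in Y$, $g\in Z$, and suppose that the boundary value problem is solvable in $V(\mathcal T_h)$: there is $u\in V(\mathcal T_h)$ with $\mathcal Au=f$, $\mathcal Bu=g$, $[[C_1u]]=[[C_2u]]=0$. For $\tau>0$ and $\mathbf M=(M_1,\dots,M_N)\in\mathbb N^N$ let $$\mathcal J^{h,\mathbf M}_\tau(v)=\sum_{k=1}^N\sum_{i=1}^{M_k}\big|(\mathcal Av-f,\varphi_{k,i})_{Y_k}\big|^2+\tau\Big(\|\mathcal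 Bv-g\|_Z^2+\|[[C_1v]]\|_{\mathcal W}^2+\|[[C_2v]]\|_{\mathcal W}^2\Big).$$ Then, for every fixed $\tau>0$ and $\mathbf M$, $$\inf_{v\in V^\sigma_{n,C_n}(\mathcal T_h)}\mathcal J^{h,\mathbf M}_\tau(v)\longrightarrow 0\qquad(n\to\infty);$$ in particular, if for all sufficiently large $n$ the function $u_n$ is a minimizer of $\mathcal J^{h,\mathbf M}_\tau$ over $V^\sigma_{n,C_n}(\mathcal T_h)$, then $\mathcal J^{h,\mathbf M}_\tau(u_n)\to0$ as $n\to\infty$. -/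

import Mathlib

open MeasureTheory Set Filter Topology
open scoped ENNReal ContDiff

noncomputable section

namespace DHNN

/-- The (open) `k`-th element of the mesh `x 0 < x 1 < ⋯ < x N`.  Lebesgue spaces on it coincide
with those on the closed element. -/
def element {N : ℕ} (x : Fin (N + 1) → ℝ) (k : Fin N) : Set ℝ :=
  Ioo (x k.castSucc) (x k.succ)

/-- `w` is the weak derivative of order `j` of `v` on the set `U`. -/
def IsWeakDeriv (U : Set ℝ) (j : ℕ) (v w : ℝ → ℂ) : Prop :=
  ∀ ψ : ℝ → ℝ, ContDiff ℝ ∞ ψ → HasCompactSupport ψ → tsupport ψ ⊆ U →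
    (∫ t in U, iteratedDeriv j ψ t • v t) = (-1 : ℂ) ^ j * (∫ t in U, ψ t • w t)

/-- Families `(v_{k,j})`, `1 ≤ k ≤ N`, `0 ≤ j ≤ s`, with `v_{k,j} ∈ L^p(Ω_k)`, normed by
`(∑_{k,j} ‖v_{k,j}‖_{L^p(Ω_k)}^p)^{1/p}`. -/
abbrev ElementJets {N : ℕ} (x : Fin (N + 1) → ℝ) (s : ℕ) (p : ℝ≥0∞) : Type :=
  PiLp p (fun i : Fin N × Fin (s + 1) => Lp ℂ p (volume.restrict (element x i.1)))

theorem integrable_smul_of_test {U : Set ℝ} {p : ℝ≥0∞} [Fact (1 ≤ p)]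
    (f : Lp ℂ p (volume.restrict U)) {ψ : ℝ → ℝ} (hψ : Continuous ψ) (hc : HasCompactSupport ψ) :
    Integrable (fun t => ψ t • f t) (volume.restrict U) := by
  have h1 : LocallyIntegrable (f : ℝ → ℂ) (volume.restrict U) :=
    (Lp.memLp f).locallyIntegrable (Fact.out)
  exact h1.integrable_smul_left_of_hasCompactSupport hψ hc

theorem hasCompactSupport_iteratedDeriv {ψ : ℝ → ℝ} (hc : HasCompactSupport ψ) (j : ℕ) :
    HasCompactSupport (iteratedDeriv j ψ) := by
  induction j with
  | zero => simpa [iteratedDeriv_zero] using hc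
  | succ j ih => rw [iteratedDeriv_succ]; exact ih.deriv

/-- The broken Sobolev space `W^{s,p}(𝒯_h)`: functions which are in `L^p` on every element together
with their weak derivatives of order at most `s` on every element.  A function `v` is stored with
its elementwise weak derivatives (which it determines almost everywhere): the component `(k, j)` is
the weak derivative `D^j v` on the `k`-th element, and the component `(k, 0)` is `v` itself there.
The norm is the usual one, `(∑_{k,j} ‖D^j v‖_{L^p(Ω_k)}^p)^{1/p}`. -/
def brokenSobolev {N : ℕ} (x : Fin (N + 1) → ℝ) (s : ℕ) (p : ℝ≥0∞) [Fact (1 ≤ p)] :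
    Submodule ℂ (ElementJets x s p) where
  carrier := {v | ∀ (k : Fin N) (j : Fin (s + 1)),
    IsWeakDeriv (element x k) j (v (k, 0)) (v (k, j))}
  zero_mem' := by
    intro k j ψ _ _ _
    have h0 : ∀ i : Fin N × Fin (s + 1), ((0 : ElementJets x s p) i : ℝ → ℂ)
        =ᵐ[volume.restrict (element x i.1)] 0 := fun i => Lp.coeFn_zero ℂ p _
    have e1 : ∫ t in element x k, iteratedDeriv j ψ t • ((0 : ElementJets x s p) (k, 0)) t = 0 := by
      rw [← integral_zero ℝ ℂ (μ := volume.restrict (element x k))]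
      refine integral_congr_ae ?_
      filter_upwards [h0 (k, 0)] with t ht
      rw [ht, Pi.zero_apply, smul_zero]
    have e2 : ∫ t in element x k, ψ t • ((0 : ElementJets x s p) (k, j)) t = 0 := by
      rw [← integral_zero ℝ ℂ (μ := volume.restrict (element x k))]
      refine integral_congr_ae ?_
      filter_upwards [h0 (k, j)] with t ht
      rw [ht, Pi.zero_apply, smul_zero]
    rw [e1, e2, mul_zero]
  add_mem' := by
    intro v w hv hw k j ψ h1 h2 h3
    have key : ∀ (i : Fin (s + 1)) (χ : ℝ → ℝ), Continuous χ → HasCompactSupport χ →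
        ∫ t in element x k, χ t • ((v + w) (k, i)) t =
          (∫ t in element x k, χ t • (v (k, i)) t) + ∫ t in element x k, χ t • (w (k, i)) t := by
      intro i χ hχ hχc
      rw [← integral_add (integrable_smul_of_test _ hχ hχc) (integrable_smul_of_test _ hχ hχc)]
      refine integral_congr_ae ?_
      filter_upwards [Lp.coeFn_add (v (k, i)) (w (k, i))] with t ht
      rw [PiLp.add_apply, ht, Pi.add_apply, smul_add]
    rw [key 0 _ (h1.continuous_iteratedDeriv j (by exact_mod_cast le_top))
        (hasCompactSupport_iteratedDeriv h2 _), key j _ h1.continuous h2, hv k j ψ h1 h2 h3,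
      hw k j ψ h1 h2 h3, mul_add]
  smul_mem' := by
    intro c v hv k j ψ h1 h2 h3
    have key : ∀ (i : Fin (s + 1)) (χ : ℝ → ℝ),
        ∫ t in element x k, χ t • ((c • v) (k, i)) t =
          c * ∫ t in element x k, χ t • (v (k, i)) t := by
      intro i χ
      rw [← integral_const_mul]
      refine integral_congr_ae ?_
      filter_upwards [Lp.coeFn_smul c (v (k, i))] with t ht
      rw [PiLp.smul_apply, ht, Pi.smul_apply, smul_eq_mul, mul_smul_comm]
    rw [key, key, hv k j ψ h1 h2 h3]
    ring

/-- The element `v` of the broken Sobolev space is (the class of) the function that equals `F k` on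
the `k`-th element. -/
def Represents {N : ℕ} {x : Fin (N + 1) → ℝ} {s : ℕ} {p : ℝ≥0∞} [Fact (1 ≤ p)]
    (v : brokenSobolev x s p) (F : Fin N → ℝ → ℂ) : Prop :=
  ∀ k : Fin N, ((v : ElementJets x s p) (k, 0) : ℝ → ℂ) =ᵐ[volume.restrict (element x k)] F k

/-- Parameters `Θ = [W, b, c]` of a discontinuous network of width `n` on `N` elements. -/
structure Params (N n : ℕ) where
  /-- weights -/
  W : Fin N → Fin n → ℝ
  /-- biases -/
  b : Fin N → Fin n → ℝ
  /-- linear parameters -/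
  c : Fin N → Fin n → ℂ

/-- `‖Θ‖ = max_k (max_j |W_j^k| + max_j |b_j^k| + max_j |c_j^k|)`; the norms on the right are
maximum norms. -/
def Params.size {N n : ℕ} (Θ : Params N n) : ℝ :=
  ⨆ k : Fin N, (‖Θ.W k‖ + ‖Θ.b k‖ + ‖Θ.c k‖)

/-- The network function, on the `k`-th element: `t ↦ ∑_j c_j^k σ(W_j^k t + b_j^k)`. -/
def network (σ : ℝ → ℂ) {N n : ℕ} (Θ : Params N n) (k : Fin N) (t : ℝ) : ℂ :=
  ∑ j : Fin n, Θ.c k j * σ (Θ.W k j * t + Θ.b k j)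

/-- The set `V^σ_{n,C}(𝒯_h)` of networks of width `n` with parameters of size `< C`, inside the
broken Sobolev space. -/
def boundedNetworks (σ : ℝ → ℂ) {N : ℕ} (x : Fin (N + 1) → ℝ) (s : ℕ) (p : ℝ≥0∞) [Fact (1 ≤ p)]
    (n : ℕ) (C : ℝ) : Set (brokenSobolev x s p) :=
  {v | ∃ Θ : Params N n, Θ.size < C ∧ Represents v (network σ Θ)}

section Loss

variable {N : ℕ} {V Y Z W : Type*} {Yk : Fin N → Type*}
  [NormedAddCommGroup V] [NormedSpace ℂ V]
  [NormedAddCommGroup Y] [InnerProductSpace ℂ Y]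
  [∀ k, NormedAddCommGroup (Yk k)] [∀ k, InnerProductSpace ℂ (Yk k)]
  [NormedAddCommGroup Z] [NormedSpace ℂ Z]
  [NormedAddCommGroup W] [NormedSpace ℂ W]

/-- Truncated residual loss `∑_k ∑_{i=1}^{M_k} |(𝒜v - f, φ_{k,i})_{Y_k}|²`.  The space `Y_k` is the
restriction of `Y` to the `k`-th element; `restr` sends `y ∈ Y` to the family of its restrictions.
The basis of `Y_k` is numbered from `0`. -/
def truncatedResidual (restr : Y ≃ₗᵢ[ℂ] PiLp 2 Yk) (φ : ∀ k, HilbertBasis ℕ ℂ (Yk k))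
    (A : V →L[ℂ] Y) (f : Y) (M : Fin N → ℕ) (v : V) : ℝ :=
  ∑ k : Fin N, ∑ i ∈ Finset.range (M k), ‖inner ℂ (φ k i) (restr (A v - f) k)‖ ^ 2

/-- Truncated hybrid loss `J_τ^{h,M}(v)`: truncated residual loss plus `τ` times the sum of the
boundary loss `‖ℬv - g‖²` and the interface loss `‖[[C₁v]]‖² + ‖[[C₂v]]‖²`. The arguments `J₁`, `J₂`
are the jump operators `v ↦ [[C₁v]]`, `v ↦ [[C₂v]]`. -/
def truncatedLoss (restr : Y ≃ₗᵢ[ℂ] PiLp 2 Yk) (φ : ∀ k, HilbertBasis ℕ ℂ (Yk k))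
    (A : V →L[ℂ] Y) (f : Y) (B : V →L[ℂ] Z) (g : Z) (J₁ J₂ : V →L[ℂ] W)
    (τ : ℝ) (M : Fin N → ℕ) (v : V) : ℝ :=
  truncatedResidual restr φ A f M v + τ * (‖B v - g‖ ^ 2 + (‖J₁ v‖ ^ 2 + ‖J₂ v‖ ^ 2))

end Loss

end DHNN

end

/-! The loss is continuous and nonnegative on the broken Sobolev space and vanishes at a solution,
so it is below any `ε > 0` near that solution. If the networks of arbitrary width are dense
(`dense_networks`), some network `v` has loss below `ε`. Padding with zero neurons keeps the
function and does not raise the parameter size, so `C n → ∞` puts `v` in the admissible set for all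
large `n`; infimum and minimizers are then below `ε`.

Density is a question about one element, because zero output coefficients switch a network off on
the other elements. On an interval, let `E` be a closed space of jets (a function with its weak
derivatives up to order `s`) that contains those of all `σ (W · + c)`, `W ≠ 0`. Translation is
continuous in `L^p` for `p < ∞`, so `E` contains averages over the bias, as Bochner integrals
(`smoothJet_average_mem`). Some average `τ` is smooth, bounded and not constant: otherwise the
mollifications of `σ` would be constants converging a.e. to `σ` (`exists_average_not_const`). A
bounded nonconstant function is no polynomial, so for each `m` some `c` has `τ^(m)(c) ≠ 0`. Taylor
expansion of `τ (W t + c)` as `W → 0` then yields `t^m`, with all derivatives, once the lower powers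
are in `E` (`polyJet_mem`). Finally, polynomials are dense in `W^{s,p}` of an interval: approximate
the highest derivative by Weierstrass, integrate, and adjust the constants
(`exists_polynomial_eLpNorm_iterate_derivative_sub_le`). -/

namespace DHNN

/-! ### Calculus of weak derivatives. -/

theorem tsupport_iteratedDeriv_subset (ψ : ℝ → ℝ) (j : ℕ) :
    tsupport (iteratedDeriv j ψ) ⊆ tsupport ψ := by
  induction j with
  | zero => simp [iteratedDeriv_zero]
  | succ j ih => rw [iteratedDeriv_succ]; exact tsupport_deriv_subset.trans ih

theorem integrable_test_smul {μ : Measure ℝ} {v : ℝ → ℂ} (hv : Integrable v μ)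
    {ψ : ℝ → ℝ} (hψ : Continuous ψ) (hc : HasCompactSupport ψ) :
    Integrable (fun t => ψ t • v t) μ :=
  hv.locallyIntegrable.integrable_smul_left_of_hasCompactSupport hψ hc

theorem setIntegral_test_smul {U : Set ℝ} {ψ : ℝ → ℝ} (hψU : tsupport ψ ⊆ U) (v : ℝ → ℂ) :
    ∫ t in U, ψ t • v t = ∫ t, ψ t • v t :=
  setIntegral_eq_integral_of_forall_compl_eq_zero fun t ht => by
    rw [image_eq_zero_of_notMem_tsupport fun h => ht (hψU h), zero_smul]

theorem ae_eq_zero_of_forall_test {U : Set ℝ} (hU : IsOpen U) {v : ℝ → ℂ}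
    (hv : IntegrableOn v U)
    (h : ∀ ψ : ℝ → ℝ, ContDiff ℝ ∞ ψ → HasCompactSupport ψ → tsupport ψ ⊆ U →
      ∫ t in U, ψ t • v t = 0) : v =ᵐ[volume.restrict U] 0 := by
  refine (ae_restrict_iff' hU.measurableSet).2 ?_
  refine hU.ae_eq_zero_of_integral_contDiff_smul_eq_zero hv.locallyIntegrableOn ?_
  intro ψ h1 h2 h3
  rw [← setIntegral_test_smul h3]
  exact h ψ h1 h2 h3

theorem ae_eq_of_forall_test {U : Set ℝ} (hU : IsOpen U) {v w : ℝ → ℂ}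
    (hv : IntegrableOn v U) (hw : IntegrableOn w U)
    (h : ∀ ψ : ℝ → ℝ, ContDiff ℝ ∞ ψ → HasCompactSupport ψ → tsupport ψ ⊆ U →
      ∫ t in U, ψ t • v t = ∫ t in U, ψ t • w t) : v =ᵐ[volume.restrict U] w := by
  have := ae_eq_zero_of_forall_test hU (hv.sub hw) (fun ψ h1 h2 h3 => by
    have : ∀ t, ψ t • (v - w) t = ψ t • v t - ψ t • w t := fun t => by
      rw [Pi.sub_apply, smul_sub]
    simp_rw [this]
    rw [integral_sub (integrable_test_smul hv h1.continuous h2)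
      (integrable_test_smul hw h1.continuous h2), h ψ h1 h2 h3, sub_self])
  filter_upwards [this] with t ht
  exact sub_eq_zero.1 ht

theorem IsWeakDeriv.unique {U : Set ℝ} (hU : IsOpen U) {j : ℕ} {v w w' : ℝ → ℂ}
    (hw : IntegrableOn w U) (hw' : IntegrableOn w' U)
    (h : IsWeakDeriv U j v w) (h' : IsWeakDeriv U j v w') : w =ᵐ[volume.restrict U] w' := by
  refine ae_eq_of_forall_test hU hw hw' fun ψ h1 h2 h3 => ?_
  have := (h ψ h1 h2 h3).symm.trans (h' ψ h1 h2 h3)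
  exact mul_left_cancel₀ (pow_ne_zero _ (by norm_num)) this

theorem IsWeakDeriv.congr {U : Set ℝ} {j : ℕ} {v w v' w' : ℝ → ℂ}
    (h : IsWeakDeriv U j v w) (hv : v =ᵐ[volume.restrict U] v')
    (hw : w =ᵐ[volume.restrict U] w') : IsWeakDeriv U j v' w' := by
  intro ψ h1 h2 h3
  have e1 : ∫ t in U, iteratedDeriv j ψ t • v' t = ∫ t in U, iteratedDeriv j ψ t • v t :=
    integral_congr_ae (by filter_upwards [hv] with t ht; rw [ht])
  have e2 : ∫ t in U, ψ t • w' t = ∫ t in U, ψ t • w t :=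
    integral_congr_ae (by filter_upwards [hw] with t ht; rw [ht])
  rw [e1, e2, h ψ h1 h2 h3]

theorem IsWeakDeriv.sub {U : Set ℝ} {j : ℕ} {v w v' w' : ℝ → ℂ}
    (hv : IntegrableOn v U) (hw : IntegrableOn w U)
    (hv' : IntegrableOn v' U) (hw' : IntegrableOn w' U)
    (h : IsWeakDeriv U j v w) (h' : IsWeakDeriv U j v' w') :
    IsWeakDeriv U j (fun t => v t - v' t) (fun t => w t - w' t) := by
  intro ψ h1 h2 h3
  have hj : Continuous (iteratedDeriv j ψ) :=
    h1.continuous_iteratedDeriv j (by exact_mod_cast le_top)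
  have hjc := hasCompactSupport_iteratedDeriv h2 j
  simp_rw [smul_sub]
  rw [integral_sub (integrable_test_smul hv hj hjc) (integrable_test_smul hv' hj hjc),
    integral_sub (integrable_test_smul hw h1.continuous h2)
      (integrable_test_smul hw' h1.continuous h2), h ψ h1 h2 h3, h' ψ h1 h2 h3, mul_sub]

/-- Consecutive weak derivatives of `v` are weak derivatives of each other. -/
theorem IsWeakDeriv.succ_of {U : Set ℝ} {j : ℕ} {v w w' : ℝ → ℂ}
    (h : IsWeakDeriv U j v w) (h' : IsWeakDeriv U (j + 1) v w') : IsWeakDeriv U 1 w w' := by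
  intro ψ h1 h2 h3
  have h1' : ContDiff ℝ ∞ (deriv ψ) := (contDiff_infty_iff_deriv.1 h1).2
  have a := h (deriv ψ) h1' h2.deriv (tsupport_deriv_subset.trans h3)
  have b := h' ψ h1 h2 h3
  rw [iteratedDeriv_succ', a, pow_succ, mul_assoc] at b
  rw [iteratedDeriv_one, mul_left_cancel₀ (pow_ne_zero _ (by norm_num)) b]
  ring

theorem isWeakDeriv_zero {U : Set ℝ} (v : ℝ → ℂ) : IsWeakDeriv U 0 v v := by
  intro ψ _ _ _
  simp [iteratedDeriv_zero]

/-- Weak derivatives under an affine change of variables. -/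
theorem IsWeakDeriv.comp_affine {U U' : Set ℝ} {j : ℕ} {v w : ℝ → ℂ}
    (h : IsWeakDeriv U j v w) {κ : ℝ} (hκ : κ ≠ 0) (ν : ℝ)
    (hU : ∀ t ∈ U', κ * t + ν ∈ U) :
    IsWeakDeriv U' j (fun t => v (κ * t + ν)) (fun t => (κ : ℂ) ^ j * w (κ * t + ν)) := by
  intro ψ h1 h2 h3
  have hcv : ∀ F : ℝ → ℂ, ∫ t, F (κ * t + ν) = |κ⁻¹| • ∫ y, F y := fun F => by
    rw [Measure.integral_comp_mul_left (fun y => F (y + ν)) κ, integral_add_right_eq_self]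
  -- The test function is carried over by the inverse map. Its `j`th derivative gains `κ⁻¹ ^ j`,
  -- which the factor `κ ^ j` compensates; the Jacobian `|κ⁻¹|` is common to both sides.
  set ψ' : ℝ → ℝ := fun y => ψ (κ⁻¹ * y + -(κ⁻¹ * ν)) with hψ'
  have hinv : ∀ t, κ⁻¹ * (κ * t + ν) + -(κ⁻¹ * ν) = t := fun t => by field_simp; ring
  have hinv' : ∀ y, κ * (κ⁻¹ * y + -(κ⁻¹ * ν)) + ν = y := fun y => by field_simp; ring
  have hit : ∀ i y, iteratedDeriv i ψ' y = (κ⁻¹) ^ i * iteratedDeriv i ψ (κ⁻¹ * y + -(κ⁻¹ * ν)) := by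
    intro i y
    have e := iteratedDeriv_comp_const_mul (n := i) (f := fun z => ψ (z + -(κ⁻¹ * ν)))
      ((h1.comp (contDiff_id.add contDiff_const)).of_le (by exact_mod_cast le_top)) κ⁻¹
    rw [iteratedDeriv_comp_add_const] at e
    exact congrFun e y
  have hs1 : ContDiff ℝ ∞ ψ' :=
    h1.comp ((contDiff_const.mul contDiff_id).add contDiff_const)
  let e : ℝ ≃ₜ ℝ := (Homeomorph.mulLeft₀ κ⁻¹ (inv_ne_zero hκ)).trans
    (Homeomorph.addRight (-(κ⁻¹ * ν)))
  have he : ψ' = ψ ∘ e := by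
    funext y; rfl
  have hs2 : HasCompactSupport ψ' := he ▸ h2.comp_homeomorph e
  have hs3 : tsupport ψ' ⊆ U := by
    rw [he, tsupport_comp_eq_preimage]
    intro y hy
    have := hU _ (h3 hy)
    have h5 : κ * e y + ν = y := hinv' y
    rwa [h5] at this
  have key := h ψ' hs1 hs2 hs3
  rw [setIntegral_test_smul ((tsupport_iteratedDeriv_subset ψ' j).trans hs3),
    setIntegral_test_smul hs3] at key
  rw [setIntegral_test_smul ((tsupport_iteratedDeriv_subset ψ j).trans h3),
    setIntegral_test_smul h3]
  have e1 : ∫ t, iteratedDeriv j ψ t • v (κ * t + ν) =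
      |κ⁻¹| • ((κ : ℂ) ^ j * ∫ y, iteratedDeriv j ψ' y • v y) := by
    have := hcv (fun y => (κ : ℂ) ^ j * (iteratedDeriv j ψ' y • v y))
    rw [← integral_const_mul, ← this]
    congr 1; funext t
    rw [hit, hinv, inv_pow]
    have : (κ : ℂ) ≠ 0 := by exact_mod_cast hκ
    simp only [Complex.real_smul]
    push_cast
    field_simp
  have e2 : ∫ t, ψ t • ((κ : ℂ) ^ j * w (κ * t + ν)) =
      |κ⁻¹| • ((κ : ℂ) ^ j * ∫ y, ψ' y • w y) := by
    have := hcv (fun y => (κ : ℂ) ^ j * (ψ' y • w y))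
    rw [← integral_const_mul, ← this]
    congr 1; funext t
    simp only [hψ', hinv, Complex.real_smul]
    ring
  rw [e1, e2, key]
  simp only [Complex.real_smul]
  ring

/-- Integration by parts on the whole line; the compact support of `ψ` makes all products integrable
and removes boundary terms. -/
theorem isWeakDeriv_one_of_hasDerivAt {U : Set ℝ} {g g' : ℝ → ℂ}
    (hg : ∀ t, HasDerivAt g (g' t) t) (hg' : Continuous g') : IsWeakDeriv U 1 g g' := by
  intro ψ h1 h2 h3
  have hd : ∀ t, HasDerivAt ψ (deriv ψ t) t := fun t =>
    (h1.differentiable (by simp) t).hasDerivAt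
  have hgc : Continuous g := continuous_iff_continuousAt.2 fun t => (hg t).continuousAt
  have hdc : Continuous (deriv ψ) := h1.continuous_deriv (by simp)
  rw [setIntegral_test_smul ((tsupport_iteratedDeriv_subset ψ 1).trans h3),
    setIntegral_test_smul h3, iteratedDeriv_one]
  have := integral_bilinear_hasDerivAt_right_eq_neg_left_of_integrable
    (L := ContinuousLinearMap.lsmul ℝ ℝ) (u := ψ) (v := g) (u' := deriv ψ) (v' := g')
    (fun t _ => hd t) (fun t _ => hg t)
    ((h1.continuous.smul hg').integrable_of_hasCompactSupport h2.smul_right)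
    ((hdc.smul hgc).integrable_of_hasCompactSupport h2.deriv.smul_right)
    ((h1.continuous.smul hgc).integrable_of_hasCompactSupport h2.smul_right)
  simp only [ContinuousLinearMap.lsmul_apply] at this
  rw [this]; simp

/-- Classical derivatives are weak derivatives. -/
theorem isWeakDeriv_iteratedDeriv {U : Set ℝ} {g : ℝ → ℂ} (hg : ContDiff ℝ ∞ g) (j : ℕ) :
    IsWeakDeriv U j g (iteratedDeriv j g) := by
  induction j with
  | zero => rw [iteratedDeriv_zero]; exact isWeakDeriv_zero g
  | succ j ih =>
    intro ψ h1 h2 h3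
    have h1' : ContDiff ℝ ∞ (deriv ψ) := (contDiff_infty_iff_deriv.1 h1).2
    have a := ih (deriv ψ) h1' h2.deriv (tsupport_deriv_subset.trans h3)
    have hd : ∀ t, HasDerivAt (iteratedDeriv j g) (iteratedDeriv (j + 1) g t) t := fun t => by
      rw [iteratedDeriv_succ]
      exact (hg.differentiable_iteratedDeriv j (by exact_mod_cast ENat.natCast_lt_top j) t).hasDerivAt
    have b := isWeakDeriv_one_of_hasDerivAt (U := U) hd
      (hg.continuous_iteratedDeriv _ (by exact_mod_cast le_top)) ψ h1 h2 h3
    rw [iteratedDeriv_one] at b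
    rw [iteratedDeriv_succ', a, b]
    ring

/-! ### Functions controlled by their weak derivative. -/

/-- Lemma of du Bois-Reymond. -/
theorem ae_eq_const_of_isWeakDeriv_zero {a b : ℝ} (hab : a < b) {f : ℝ → ℂ}
    (hf : IntegrableOn f (Ioo a b)) (h : IsWeakDeriv (Ioo a b) 1 f 0) :
    ∃ c : ℂ, f =ᵐ[volume.restrict (Ioo a b)] fun _ => c := by
  let φ : ContDiffBump ((a + b) / 2) := ⟨(b - a) / 8, (b - a) / 4, by linarith, by linarith⟩
  set θ : ℝ → ℝ := φ.normed volume with hθ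
  have hθ1 : ContDiff ℝ ∞ θ := φ.contDiff_normed
  have hθ2 : HasCompactSupport θ := φ.hasCompactSupport_normed
  have hθ3 : tsupport θ ⊆ Ioo a b := by
    rw [hθ, φ.tsupport_normed_eq, Real.closedBall_eq_Icc]
    intro t ht
    have h1 := ht.1
    have h2 := ht.2
    simp only [φ] at h1 h2
    exact ⟨by linarith, by linarith⟩
  have hθ4 : ∫ t, θ t = 1 := φ.integral_normed
  refine ⟨∫ t in Ioo a b, θ t • f t, ?_⟩
  set c : ℂ := ∫ t in Ioo a b, θ t • f t with hc
  refine ae_eq_of_forall_test isOpen_Ioo hf (by simp) fun χ h1 h2 h3 => ?_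
  set m : ℝ := ∫ t, χ t with hm
  -- Subtracting `m * θ` makes the mean zero, so the primitive `ψ` of `ρ` is again a test function
  -- in `(a, b)`; testing `h` with it gives `∫ χ f = m c`.
  set ρ : ℝ → ℝ := fun t => χ t - m * θ t with hρ
  have hρc : ContDiff ℝ ∞ ρ := h1.sub (contDiff_const.mul hθ1)
  have hρ0 : ∫ t, ρ t = 0 := by
    rw [hρ, integral_sub (h1.continuous.integrable_of_hasCompactSupport h2)
      ((hθ1.continuous.integrable_of_hasCompactSupport hθ2).const_mul m), integral_const_mul, hθ4]
    simp [hm]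
  obtain ⟨a', b', ha', hb', hsub⟩ : ∃ a' b', a < a' ∧ b' < b ∧ ∀ t, t ∉ Icc a' b' → ρ t = 0 := by
    have hK : IsCompact (tsupport χ ∪ tsupport θ) := h2.isCompact.union hθ2.isCompact
    have hne : (tsupport χ ∪ tsupport θ).Nonempty := by
      by_contra hcon
      rw [not_nonempty_iff_eq_empty, union_empty_iff] at hcon
      have : ∀ t, θ t = 0 := fun t => image_eq_zero_of_notMem_tsupport (by simp [hcon.2])
      simp [this] at hθ4
    have hKU : tsupport χ ∪ tsupport θ ⊆ Ioo a b := union_subset h3 hθ3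
    obtain ⟨a', ha'⟩ := hK.exists_isLeast hne
    obtain ⟨b', hb'⟩ := hK.exists_isGreatest hne
    refine ⟨a', b', (hKU ha'.1).1, (hKU hb'.1).2, fun t ht => ?_⟩
    have : t ∉ tsupport χ ∪ tsupport θ := fun h => ht ⟨ha'.2 h, hb'.2 h⟩
    simp only [mem_union, not_or] at this
    simp [hρ, image_eq_zero_of_notMem_tsupport this.1, image_eq_zero_of_notMem_tsupport this.2]
  set ψ : ℝ → ℝ := fun t => ∫ u in a..t, ρ u with hψ
  have hψd : ∀ t, HasDerivAt ψ (ρ t) t := fun t =>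
    intervalIntegral.integral_hasDerivAt_right (hρc.continuous.intervalIntegrable _ _)
      hρc.continuous.stronglyMeasurable.stronglyMeasurableAtFilter hρc.continuous.continuousAt
  have hψ' : deriv ψ = ρ := funext fun t => (hψd t).deriv
  have hψs : ContDiff ℝ ∞ ψ :=
    contDiff_infty_iff_deriv.2 ⟨fun t => (hψd t).differentiableAt, hψ' ▸ hρc⟩
  -- Left of `a'` the integrand vanishes; right of `b'` the integral is the full mean `∫ ρ = 0`.
  have hψ0 : ∀ t, t ∉ Icc a' b' → ψ t = 0 := by
    intro t ht
    rcases lt_or_ge t a' with h' | h'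
    · refine intervalIntegral.integral_zero_ae (ae_of_all _ fun u hu => hsub u fun hu' => ?_)
      have : u ≤ max a t := hu.2
      exact absurd hu'.1 (not_le.2 (this.trans_lt (max_lt ha' h')))
    · have h'' : b' < t := by
        by_contra hcon
        exact ht ⟨h', not_lt.1 hcon⟩
      rw [hψ]
      simp only
      rw [intervalIntegral.integral_eq_integral_of_support_subset, hρ0]
      intro u hu
      have : u ∈ Icc a' b' := by
        by_contra hcon
        exact hu (hsub u hcon)
      exact ⟨ha'.trans_le this.1, this.2.trans h''.le⟩
  have hψt : tsupport ψ ⊆ Icc a' b' :=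
    closure_minimal (fun t ht => by by_contra hcon; exact ht (hψ0 t hcon)) isClosed_Icc
  have key := h ψ hψs (HasCompactSupport.of_support_subset_isCompact isCompact_Icc
    (subset_closure.trans hψt)) (hψt.trans fun t ht => ⟨ha'.trans_le ht.1, ht.2.trans_lt hb'⟩)
  rw [iteratedDeriv_one, hψ'] at key
  simp only [Pi.zero_apply, smul_zero, integral_zero, mul_zero] at key
  have e : ∀ t, ρ t • f t = χ t • f t - m • (θ t • f t) := fun t => by
    simp only [hρ, sub_smul, mul_smul]
  simp_rw [e] at key
  have hθf : IntegrableOn (fun t => m • θ t • f t) (Ioo a b) :=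
    (integrable_test_smul hf hθ1.continuous hθ2).smul m
  rw [integral_sub (integrable_test_smul hf h1.continuous h2)
    hθf, integral_smul, ← hc, sub_eq_zero] at key
  rw [key, setIntegral_test_smul h3 (fun _ => c), integral_smul_const]

/-- A function with an integrable weak derivative `g` on an interval differs from a constant by
at most the integral of `‖g‖`. -/
theorem IsWeakDeriv.exists_norm_sub_const_le {a b : ℝ} (hab : a < b) {f g : ℝ → ℂ}
    (hf : IntegrableOn f (Ioo a b)) (hg : IntegrableOn g (Ioo a b))
    (h : IsWeakDeriv (Ioo a b) 1 f g) :
    ∃ c : ℂ, ∀ᵐ t ∂volume.restrict (Ioo a b), ‖f t - c‖ ≤ ∫ t in Ioo a b, ‖g t‖ := by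
  set G₀ : ℝ → ℂ := (Ioo a b).indicator g with hG₀
  have hG₀i : Integrable G₀ := hg.integrable_indicator measurableSet_Ioo
  -- A primitive of `g`, written with an indicator over the whole line so that Fubini applies to its
  -- pairing with a test function.
  set G : ℝ → ℂ := fun t => ∫ u, (Iio t).indicator G₀ u with hG
  have hGle : ∀ t, ‖G t‖ ≤ ∫ t in Ioo a b, ‖g t‖ := by
    intro t
    rw [← integral_indicator measurableSet_Ioo]
    refine (norm_integral_le_integral_norm _).trans (integral_mono
      (hG₀i.indicator measurableSet_Iio).norm ?_ fun u => ?_)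
    · exact (integrable_indicator_iff measurableSet_Ioo).2 (Integrable.norm hg)
    · refine (norm_indicator_le_norm_self _ _).trans (le_of_eq ?_)
      rw [hG₀, norm_indicator_eq_indicator_norm]
  have hprod : ∀ χ : ℝ → ℝ, Continuous χ → HasCompactSupport χ →
      Integrable (fun z : ℝ × ℝ => χ z.1 • (Iio z.1).indicator G₀ z.2) (volume.prod volume) := by
    intro χ hχ hχc
    have h1 := (hχ.integrable_of_hasCompactSupport hχc (μ := volume)).smul_prod hG₀i
    have h2 := h1.indicator (s := {z : ℝ × ℝ | z.2 < z.1})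
      (measurableSet_lt measurable_snd measurable_fst)
    refine h2.congr (ae_of_all _ fun z => ?_)
    by_cases hz : z.2 < z.1
    · simp [indicator, hz]
    · simp [indicator, hz]
  have hGm : AEStronglyMeasurable G volume := by
    have hm : StronglyMeasurable (fun z : ℝ × ℝ => (Iio z.1).indicator (hG₀i.1.mk G₀) z.2) := by
      have : (fun z : ℝ × ℝ => (Iio z.1).indicator (hG₀i.1.mk G₀) z.2) =
          {z : ℝ × ℝ | z.2 < z.1}.indicator (fun z => hG₀i.1.mk G₀ z.2) := by
        funext z; simp [indicator]
      rw [this]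
      exact (hG₀i.1.stronglyMeasurable_mk.comp_measurable measurable_snd).indicator
        (measurableSet_lt measurable_snd measurable_fst)
    have := hm.integral_prod_right' (ν := (volume : Measure ℝ))
    refine this.aestronglyMeasurable.congr (ae_of_all _ fun t => ?_)
    refine integral_congr_ae ?_
    filter_upwards [hG₀i.1.ae_eq_mk] with u hu
    simp [indicator, hu]
  have hGi : IntegrableOn G (Ioo a b) :=
    Measure.integrableOn_of_bounded (by simp) hGm (ae_of_all _ hGle)
  have hGw : IsWeakDeriv (Ioo a b) 1 G g := by
    intro ψ h1 h2 h3
    rw [setIntegral_test_smul ((tsupport_iteratedDeriv_subset ψ 1).trans h3), iteratedDeriv_one]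
    have hdc : Continuous (deriv ψ) := h1.continuous_deriv (by simp)
    have e1 : ∀ t, deriv ψ t • G t = ∫ u, deriv ψ t • (Iio t).indicator G₀ u := fun t => by
      rw [integral_smul]
    simp_rw [e1]
    rw [integral_integral_swap (hprod _ hdc h2.deriv)]
    have e2 : ∀ u, ∫ t, deriv ψ t • (Iio t).indicator G₀ u = -((Ioo a b).indicator
        (fun u => ψ u • g u) u) := by
      intro u
      have : ∀ t, deriv ψ t • (Iio t).indicator G₀ u =
          ((Ioi u).indicator (deriv ψ) t) • G₀ u := by
        intro t
        by_cases htu : u < t <;> simp [indicator, htu]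
      simp_rw [this]
      rw [integral_smul_const, integral_indicator measurableSet_Ioi,
        HasCompactSupport.integral_Ioi_deriv_eq (h1.of_le (by simp)) h2]
      by_cases hu : u ∈ Ioo a b
      · simp [hG₀, indicator_of_mem hu]
      · simp [hG₀, indicator_of_notMem hu]
    simp_rw [e2]
    rw [integral_neg, integral_indicator measurableSet_Ioo]
    ring
  -- `f - G` has weak derivative zero, hence is a.e. a constant, and `G` obeys the bound.
  obtain ⟨c, hc⟩ := ae_eq_const_of_isWeakDeriv_zero hab (f := fun t => f t - G t) (hf.sub hGi)
    ((h.sub hf hg hGi hg hGw).congr (ae_of_all _ fun _ => rfl) (ae_of_all _ fun t => by simp))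
  refine ⟨c, ?_⟩
  filter_upwards [hc] with t ht
  rw [← ht, sub_sub_cancel]
  exact hGle t

/-! ### Density of polynomials in the Sobolev space of an interval. -/

open Polynomial in
theorem exists_derivative_eq (q : ℂ[X]) : ∃ Q : ℂ[X], derivative Q = q := by
  induction q using Polynomial.induction_on' with
  | add p q hp hq =>
    obtain ⟨P, rfl⟩ := hp
    obtain ⟨Q, rfl⟩ := hq
    exact ⟨P + Q, derivative_add⟩
  | monomial n a =>
    refine ⟨monomial (n + 1) (a / (n + 1)), ?_⟩
    rw [derivative_monomial]
    have : (n : ℂ) + 1 ≠ 0 := by exact_mod_cast n.succ_ne_zero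
    congr 1
    push_cast
    field_simp

theorem hasDerivAt_polynomial_ofReal (P : Polynomial ℂ) (t : ℝ) :
    HasDerivAt (fun t : ℝ => P.eval (t : ℂ)) (P.derivative.eval (t : ℂ)) t :=
  (P.hasDerivAt (t : ℂ)).comp_ofReal

theorem contDiff_polynomial_ofReal (P : Polynomial ℂ) :
    ContDiff ℝ ∞ (fun t : ℝ => P.eval (t : ℂ)) := by
  have h : ContDiff ℝ ∞ (fun z : ℂ => P.eval z) := by
    simpa using (P.contDiff_aeval (R := ℂ) (𝕜 := ℂ) ∞).restrict_scalars ℝ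
  exact h.comp Complex.ofRealCLM.contDiff

theorem iteratedDeriv_polynomial_ofReal (P : Polynomial ℂ) (j : ℕ) :
    iteratedDeriv j (fun t : ℝ => P.eval (t : ℂ)) =
      fun t : ℝ => (Polynomial.derivative^[j] P).eval (t : ℂ) := by
  induction j with
  | zero => simp [iteratedDeriv_zero]
  | succ j ih =>
    rw [iteratedDeriv_succ, ih, Function.iterate_succ_apply']
    funext t
    exact (hasDerivAt_polynomial_ofReal _ t).deriv

theorem memLp_restrict_Ioo_of_continuous {a b : ℝ} {p : ℝ≥0∞} {g : ℝ → ℂ} (hg : Continuous g) :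
    MemLp g p (volume.restrict (Ioo a b)) := by
  obtain ⟨K, hK⟩ := (isCompact_Icc (a := a) (b := b)).exists_bound_of_continuousOn hg.continuousOn
  refine MemLp.of_bound hg.aestronglyMeasurable K ?_
  filter_upwards [ae_restrict_mem measurableSet_Ioo] with t ht
  exact hK t (Ioo_subset_Icc_self ht)

theorem exists_pos_mul_ofReal_le {K ε : ℝ≥0∞} (hK : K ≠ ⊤) (hε : ε ≠ 0) :
    ∃ δ : ℝ, 0 < δ ∧ K * ENNReal.ofReal δ ≤ ε := by
  obtain ⟨δ, h1, h2⟩ := ENNReal.exists_nnreal_pos_mul_lt hK hε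
  refine ⟨δ, by exact_mod_cast h1, ?_⟩
  rw [ENNReal.ofReal_coe_nnreal, mul_comm]
  exact h2.le

theorem rpow_measure_Ioo_ne_top {a b r : ℝ} (hr : 0 ≤ r) :
    (volume.restrict (Ioo a b)) univ ^ r ≠ ⊤ :=
  ENNReal.rpow_ne_top_of_nonneg hr (measure_ne_top _ _)

/-- Polynomials are dense in `L^p` of a bounded interval. -/
theorem exists_polynomial_eLpNorm_sub_le {a b : ℝ} {p : ℝ≥0∞} (hp1 : 1 ≤ p)
    (hp : p ≠ ⊤) {f : ℝ → ℂ} (hf : MemLp f p (volume.restrict (Ioo a b))) {ε : ℝ≥0∞}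
    (hε : ε ≠ 0) :
    ∃ P : Polynomial ℂ,
      eLpNorm (fun t : ℝ => P.eval (t : ℂ) - f t) p (volume.restrict (Ioo a b)) ≤ ε := by
  have hε2 : ε / 2 ≠ 0 := (ENNReal.half_pos hε).ne'
  obtain ⟨g, hg, hgm⟩ := hf.exists_boundedContinuous_eLpNorm_sub_le hp hε2
  obtain ⟨δ, hδ, hδε⟩ := exists_pos_mul_ofReal_le
    (rpow_measure_Ioo_ne_top (a := a) (b := b) (r := p.toReal⁻¹) (by positivity)) hε2
  obtain ⟨P, hP⟩ := exists_polynomial_near_of_continuousOn a b (fun t => (g t).re)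
    (Complex.continuous_re.comp g.continuous).continuousOn (δ / 2) (by linarith)
  obtain ⟨Q, hQ⟩ := exists_polynomial_near_of_continuousOn a b (fun t => (g t).im)
    (Complex.continuous_im.comp g.continuous).continuousOn (δ / 2) (by linarith)
  set R : Polynomial ℂ := P.map Complex.ofRealHom + Polynomial.C Complex.I *
    Q.map Complex.ofRealHom with hR
  have hRe : ∀ t : ℝ, R.eval (t : ℂ) = ((P.eval t : ℝ) : ℂ) + Complex.I * ((Q.eval t : ℝ) : ℂ) := by
    intro t
    have h (S : Polynomial ℝ) : (S.map Complex.ofRealHom).eval (t : ℂ) = ((S.eval t : ℝ) : ℂ) := by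
      have := Polynomial.eval_map_apply (f := Complex.ofRealHom) (p := S) t
      simpa using this
    simp [hR, h]
  refine ⟨R, ?_⟩
  have h1 : eLpNorm (fun t : ℝ => R.eval (t : ℂ) - g t) p (volume.restrict (Ioo a b)) ≤ ε / 2 := by
    refine (eLpNorm_le_of_ae_bound (C := δ) ?_).trans hδε
    filter_upwards [ae_restrict_mem measurableSet_Ioo] with t ht
    have e : R.eval (t : ℂ) - g t = ((P.eval t - (g t).re : ℝ) : ℂ) +
        Complex.I * ((Q.eval t - (g t).im : ℝ) : ℂ) := by
      rw [hRe]
      conv_lhs => rw [← Complex.re_add_im (g t)]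
      push_cast; ring
    rw [e]
    refine (norm_add_le _ _).trans ?_
    rw [norm_mul, Complex.norm_I, one_mul, Complex.norm_real, Complex.norm_real,
      Real.norm_eq_abs, Real.norm_eq_abs]
    linarith [hP t (Ioo_subset_Icc_self ht), hQ t (Ioo_subset_Icc_self ht)]
  have h2 : eLpNorm (fun t : ℝ => g t - f t) p (volume.restrict (Ioo a b)) ≤ ε / 2 := by
    rw [eLpNorm_sub_comm] at hg
    exact hg
  calc eLpNorm (fun t : ℝ => R.eval (t : ℂ) - f t) p (volume.restrict (Ioo a b))
      = eLpNorm ((fun t : ℝ => R.eval (t : ℂ) - g t) + fun t => g t - f t) p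
          (volume.restrict (Ioo a b)) := by
        congr 1; funext t; simp
    _ ≤ _ := eLpNorm_add_le
        (((contDiff_polynomial_ofReal R).continuous.sub g.continuous).aestronglyMeasurable)
        (hgm.1.sub hf.1) hp1
    _ ≤ ε / 2 + ε / 2 := add_le_add h1 h2
    _ = ε := ENNReal.add_halves ε

/-- A chain of weak derivatives in `L^p` of a bounded interval can be approximated by the
derivatives of a polynomial. -/
theorem exists_polynomial_eLpNorm_iterate_derivative_sub_le {a b : ℝ} (hab : a < b) {p : ℝ≥0∞}
    (hp1 : 1 ≤ p) (hp : p ≠ ⊤) (s : ℕ) : ∀ v : ℕ → ℝ → ℂ,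
    (∀ j ≤ s, MemLp (v j) p (volume.restrict (Ioo a b))) →
    (∀ j < s, IsWeakDeriv (Ioo a b) 1 (v j) (v (j + 1))) → ∀ ε : ℝ≥0∞, ε ≠ 0 →
    ∃ P : Polynomial ℂ, ∀ j ≤ s,
      eLpNorm (fun t : ℝ => (Polynomial.derivative^[j] P).eval (t : ℂ) - v j t) p
        (volume.restrict (Ioo a b)) ≤ ε := by
  induction s with
  | zero =>
    intro v hv _ ε hε
    obtain ⟨P, hP⟩ := exists_polynomial_eLpNorm_sub_le hp1 hp (hv 0 le_rfl) hε
    refine ⟨P, fun j hj => ?_⟩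
    obtain rfl : j = 0 := by omega
    exact hP
  | succ s ih =>
    intro v hv hw ε hε
    set μ := volume.restrict (Ioo a b) with hμ
    -- The first factor passes from a uniform bound to the `L^p` norm, the second (Hölder) from the
    -- `L^p` norm to the `L^1` norm.
    set K : ℝ≥0∞ := μ univ ^ p.toReal⁻¹ * μ univ ^ (1 / (1 : ℝ≥0∞).toReal - 1 / p.toReal) with hK
    have hKtop : K ≠ ⊤ := by
      refine ENNReal.mul_ne_top (rpow_measure_Ioo_ne_top (by positivity))
        (rpow_measure_Ioo_ne_top ?_)
      have : 1 ≤ p.toReal := by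
        rw [← ENNReal.toReal_one]; exact ENNReal.toReal_mono hp hp1
      have := inv_le_one_of_one_le₀ this
      simp only [ENNReal.toReal_one, one_div, inv_one]
      linarith
    obtain ⟨δ, hδ, hδε⟩ := exists_pos_mul_ofReal_le hKtop hε
    -- The induction hypothesis treats the shifted chain starting at `v 1`. A primitive `Q` of the
    -- result differs from `v 0` by nearly a constant `c`, and subtracting `c` changes no
    -- derivative.
    obtain ⟨q, hq⟩ := ih (fun j => v (j + 1)) (fun j hj => hv (j + 1) (by omega))
      (fun j hj => hw (j + 1) (by omega)) (min ε (ENNReal.ofReal δ))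
      (by simp [hε, hδ])
    obtain ⟨Q, rfl⟩ := exists_derivative_eq q
    have hint : ∀ {f : ℝ → ℂ}, MemLp f p μ → IntegrableOn f (Ioo a b) := fun h =>
      h.integrable hp1
    have hpol : ∀ P : Polynomial ℂ, MemLp (fun t : ℝ => P.eval (t : ℂ)) p μ := fun P =>
      memLp_restrict_Ioo_of_continuous (contDiff_polynomial_ofReal P).continuous
    have hg : MemLp (fun t : ℝ => (Polynomial.derivative Q).eval (t : ℂ) - v 1 t) p μ :=
      (hpol _).sub (hv 1 (by omega))
    obtain ⟨c, hc⟩ := IsWeakDeriv.exists_norm_sub_const_le hab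
      (hint ((hpol Q).sub (hv 0 (by omega)))) (hint hg)
      ((isWeakDeriv_one_of_hasDerivAt (hasDerivAt_polynomial_ofReal Q)
        (contDiff_polynomial_ofReal _).continuous).sub (hint (hpol _)) (hint (hpol _))
          (hint (hv 0 (by omega))) (hint (hv 1 (by omega))) (hw 0 (by omega)))
    refine ⟨Q - Polynomial.C c, fun j hj => ?_⟩
    rcases j with _ | j
    · have h1 := hq 0 (by omega)
      simp only [Function.iterate_zero, id, zero_add] at h1
      have h2 : ENNReal.ofReal (∫ t in Ioo a b, ‖(Polynomial.derivative Q).eval (t : ℂ) - v 1 t‖) ≤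
          ENNReal.ofReal δ * μ univ ^ (1 / (1 : ℝ≥0∞).toReal - 1 / p.toReal) := by
        rw [ofReal_integral_norm_eq_lintegral_enorm (hint hg), ← eLpNorm_one_eq_lintegral_enorm]
        exact (eLpNorm_le_eLpNorm_mul_rpow_measure_univ hp1 hg.1).trans
          (mul_le_mul_left (h1.trans (min_le_right _ _)) _)
      calc _ ≤ μ univ ^ p.toReal⁻¹ * ENNReal.ofReal
            (∫ t in Ioo a b, ‖(Polynomial.derivative Q).eval (t : ℂ) - v 1 t‖) := by
            refine eLpNorm_le_of_ae_bound ?_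
            filter_upwards [hc] with t ht
            refine le_trans (le_of_eq ?_) ht
            simp only [Function.iterate_zero, id, Polynomial.eval_sub, Polynomial.eval_C]
            rw [sub_right_comm]
            rfl
        _ ≤ μ univ ^ p.toReal⁻¹ *
            (ENNReal.ofReal δ * μ univ ^ (1 / (1 : ℝ≥0∞).toReal - 1 / p.toReal)) := by gcongr
        _ = K * ENNReal.ofReal δ := by rw [hK]; ring
        _ ≤ ε := hδε
    · have h1 := (hq j (by omega)).trans (min_le_left _ _)
      rwa [Function.iterate_succ_apply, Polynomial.derivative_sub, Polynomial.derivative_C,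
        sub_zero]

/-! ### A smooth bounded average that is not a polynomial. -/

/-- A bounded polynomial is constant. By induction the bounded differences `f (t + u) - f t` do not
depend on `t`, so `f (n u) - f 0 = n (f u - f 0)`, which is bounded in `n` only if `f u = f 0`. -/
theorem eq_of_bounded_of_iteratedDeriv_eq_zero (m : ℕ) : ∀ f : ℝ → ℂ, ContDiff ℝ ∞ f →
    (∃ K, ∀ t, ‖f t‖ ≤ K) → (∀ t, iteratedDeriv m f t = 0) → ∀ x y, f x = f y := by
  induction m with
  | zero =>
    intro f _ _ h x y
    simp only [iteratedDeriv_zero] at h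
    rw [h, h]
  | succ m ih =>
    rintro f hf ⟨K, hK⟩ h
    have hsm : ContDiff ℝ m f := hf.of_le (by exact_mod_cast le_top)
    have hc : ∀ x y, iteratedDeriv m f x = iteratedDeriv m f y := by
      refine is_const_of_deriv_eq_zero
        (hf.differentiable_iteratedDeriv m (by exact_mod_cast ENat.natCast_lt_top m)) fun t => ?_
      rw [← iteratedDeriv_succ]
      exact h t
    have hstep : ∀ h t, f (t + h) - f t = f (0 + h) - f 0 := by
      intro u t
      refine ih (fun t => f (t + u) - f t) ((hf.comp (contDiff_id.add contDiff_const)).sub hf)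
        ⟨K + K, fun t => (norm_sub_le _ _).trans (add_le_add (hK _) (hK _))⟩ (fun t => ?_) t 0
      have := iteratedDeriv_sub (n := m) (x := t) (f := fun t => f (t + u)) (g := f)
        (hsm.comp (contDiff_id.add contDiff_const)).contDiffAt hsm.contDiffAt
      rw [iteratedDeriv_comp_add_const] at this
      refine this.trans ?_
      change iteratedDeriv m f (t + u) - iteratedDeriv m f t = 0
      rw [hc (t + u) t, sub_self]
    have hmul : ∀ (u : ℝ) (n : ℕ), f (n * u) - f 0 = n * (f (0 + u) - f 0) := by
      intro u n
      induction n with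
      | zero => simp
      | succ n ihn =>
        have := hstep u (n * u)
        push_cast
        rw [show ((n : ℝ) + 1) * u = n * u + u by ring, add_mul, ← ihn, one_mul, ← this]
        ring
    have h0 : ∀ u, f u = f 0 := by
      intro u
      by_contra hne
      have hpos : 0 < ‖f u - f 0‖ := norm_pos_iff.2 (sub_ne_zero.2 hne)
      obtain ⟨n, hn⟩ := exists_nat_gt ((K + K) / ‖f u - f 0‖)
      rw [div_lt_iff₀ hpos] at hn
      have h1 := hmul u n
      rw [zero_add] at h1
      have h2 : ‖f (n * u) - f 0‖ ≤ K + K := (norm_sub_le _ _).trans (add_le_add (hK _) (hK _))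
      rw [h1, norm_mul, Complex.norm_natCast] at h2
      linarith
    intro x y
    rw [h0 x, h0 y]

/-- Some average of a bounded function that is not almost everywhere constant is smooth, bounded
and not constant. -/
theorem exists_average_not_const {σ : ℝ → ℂ} (hσm : Measurable σ) {K : ℝ}
    (hσK : ∀ t, ‖σ t‖ ≤ K) (hσ : ¬ ∃ c : ℂ, ∀ᵐ t : ℝ, σ t = c) :
    ∃ χ : ℝ → ℝ, Continuous χ ∧ HasCompactSupport χ ∧
      ContDiff ℝ ∞ (fun t => ∫ x, χ x • σ (t + x)) ∧
      (∃ K', ∀ t, ‖∫ x, χ x • σ (t + x)‖ ≤ K') ∧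
      ¬ ∀ t u, (∫ x, χ x • σ (t + x)) = ∫ x, χ x • σ (u + x) := by
  have hloc : LocallyIntegrable σ volume :=
    (memLp_top_of_bound hσm.aestronglyMeasurable K (ae_of_all _ hσK)).locallyIntegrable le_top
  -- The outer radius tends to zero while its ratio to the inner one stays `2`, as the a.e.
  -- convergence of mollifications requires.
  let φ : ℕ → ContDiffBump (0 : ℝ) := fun n =>
    ⟨1 / (n + 1), 2 / (n + 1), by positivity, by gcongr; norm_num⟩
  have hconv : ∀ n t, convolution ((φ n).normed volume) σ (ContinuousLinearMap.lsmul ℝ ℝ) volume t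
      = ∫ x, (φ n).normed volume x • σ (t + x) := by
    intro n t
    rw [convolution_def, ← integral_neg_eq_self]
    simp only [ContinuousLinearMap.lsmul_apply, (φ n).normed_neg, sub_neg_eq_add]
  have hsm : ∀ n, ContDiff ℝ ∞ (fun t => ∫ x, (φ n).normed volume x • σ (t + x)) := by
    intro n
    have := ((φ n).hasCompactSupport_normed (μ := volume)).contDiff_convolution_left (n := ⊤)
      (μ := volume)
      (ContinuousLinearMap.lsmul ℝ ℝ) (φ n).contDiff_normed hloc
    rwa [funext (hconv n)] at this
  by_contra hcon
  have hall : ∀ n t u, (∫ x, (φ n).normed volume x • σ (t + x)) =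
      ∫ x, (φ n).normed volume x • σ (u + x) := by
    intro n
    by_contra hn
    refine hcon ⟨(φ n).normed volume, (φ n).continuous_normed, (φ n).hasCompactSupport_normed,
      hsm n, ⟨∫ x, ‖(φ n).normed volume x‖ * K, fun t => ?_⟩, hn⟩
    refine norm_integral_le_of_norm_le ((φ n).integrable_normed.norm.mul_const K)
      (ae_of_all _ fun x => ?_)
    rw [norm_smul]
    exact mul_le_mul_of_nonneg_left (hσK _) (norm_nonneg _)
  -- Since every average is constant in `t`, one sequence, its values at `0`, converges to `σ t` for
  -- a.e. `t`; uniqueness of limits makes `σ` a.e. constant.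
  have hlim : ∀ᵐ t : ℝ, Tendsto (fun n => ∫ x, (φ n).normed volume x • σ (0 + x)) atTop
      (𝓝 (σ t)) := by
    have := ContDiffBump.ae_convolution_tendsto_right_of_locallyIntegrable (μ := volume)
      (φ := φ) (l := atTop) (K := 2) (g := σ) ?_ ?_ hloc
    · filter_upwards [this] with t ht
      simp_rw [hconv] at ht
      simpa only [fun n => hall n t 0] using ht
    · change Tendsto (fun n : ℕ => (2 : ℝ) / (n + 1)) atTop (𝓝 0)
      simpa [div_eq_mul_inv] using
        (tendsto_one_div_add_atTop_nhds_zero_nat (𝕜 := ℝ)).const_mul 2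
    · refine Eventually.of_forall fun n => le_of_eq ?_
      change (2 : ℝ) / (n + 1) = 2 * (1 / (n + 1))
      ring
  obtain ⟨t₀, ht₀⟩ := hlim.exists
  refine hσ ⟨σ t₀, ?_⟩
  filter_upwards [hlim] with t ht
  exact tendsto_nhds_unique ht ht₀

/-! ### Jets on one interval. -/

section Jets

set_option linter.unusedSectionVars false

/-- Families of `L^p` functions `(w_0, …, w_s)` on an interval. -/
abbrev IntervalJets (a b : ℝ) (s : ℕ) (p : ℝ≥0∞) : Type :=
  Fin (s + 1) → Lp ℂ p (volume.restrict (Ioo a b))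

variable {a b : ℝ} {s : ℕ} {p : ℝ≥0∞} [Fact (1 ≤ p)]

/-- The family consists of a function and its weak derivatives. -/
def IsWeakJet (w : IntervalJets a b s p) : Prop :=
  ∀ j : Fin (s + 1), IsWeakDeriv (Ioo a b) j (w 0) (w j)

theorem integrableOn_Lp (f : Lp ℂ p (volume.restrict (Ioo a b))) : IntegrableOn f (Ioo a b) :=
  (Lp.memLp f).integrable Fact.out

/-- Uniqueness of weak derivatives: jets may be identified by comparing functions only. -/
theorem IsWeakJet.ext {w w' : IntervalJets a b s p} (h : IsWeakJet w) (h' : IsWeakJet w')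
    (h0 : w 0 =ᵐ[volume.restrict (Ioo a b)] w' 0) : w = w' := by
  funext j
  refine Lp.ext ?_
  exact IsWeakDeriv.unique isOpen_Ioo (integrableOn_Lp _) (integrableOn_Lp _) (h j)
    ((h' j).congr h0.symm (ae_eq_refl _))

/-- The jet of a smooth function. -/
noncomputable def smoothJet (a b : ℝ) (s : ℕ) (p : ℝ≥0∞) {g : ℝ → ℂ} (hg : ContDiff ℝ ∞ g) :
    IntervalJets a b s p :=
  fun j => (memLp_restrict_Ioo_of_continuous
    (hg.continuous_iteratedDeriv j (by exact_mod_cast le_top))).toLp (iteratedDeriv j g)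

theorem smoothJet_coeFn {g : ℝ → ℂ} (hg : ContDiff ℝ ∞ g) (j : Fin (s + 1)) :
    smoothJet a b s p hg j =ᵐ[volume.restrict (Ioo a b)] iteratedDeriv j g :=
  MemLp.coeFn_toLp _

theorem isWeakJet_smoothJet {g : ℝ → ℂ} (hg : ContDiff ℝ ∞ g) :
    IsWeakJet (smoothJet a b s p hg) := by
  intro j
  refine (isWeakDeriv_iteratedDeriv hg j).congr ?_ (smoothJet_coeFn hg j).symm
  have := (smoothJet_coeFn (a := a) (b := b) (s := s) (p := p) hg 0).symm
  rwa [Fin.val_zero, iteratedDeriv_zero] at this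

/-- Integration against a test function, as a continuous functional on `L^p`. -/
theorem exists_clm_integral_test_smul {ψ : ℝ → ℝ} (hψ : Continuous ψ) :
    ∃ Λ : Lp ℂ p (volume.restrict (Ioo a b)) →L[ℂ] ℂ,
      ∀ f, Λ f = ∫ t in Ioo a b, ψ t • f t := by
  have : ENNReal.HolderConjugate p p.conjExponent := .conjExponent Fact.out
  have : Fact (1 ≤ p.conjExponent) := 
    ⟨ENNReal.HolderConjugate.one_le p.conjExponent p⟩
  have hm : MemLp (fun t => (ψ t : ℂ)) p.conjExponent (volume.restrict (Ioo a b)) :=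
    memLp_restrict_Ioo_of_continuous (Complex.continuous_ofReal.comp hψ)
  refine ⟨((ContinuousLinearMap.mul ℂ ℂ).lpPairing (volume.restrict (Ioo a b)) p
    p.conjExponent).flip (hm.toLp _), fun f => ?_⟩
  rw [ContinuousLinearMap.flip_apply, ContinuousLinearMap.lpPairing_eq_integral]
  refine integral_congr_ae ?_
  filter_upwards [hm.coeFn_toLp] with t ht
  rw [ht, ContinuousLinearMap.mul_apply', Complex.real_smul, mul_comm]

/-- The projection to the quotient by `E` is continuous, commutes with the integral and kills the
integrand. -/
theorem integral_mem_of_isClosed {X V : Type*} [MeasurableSpace X] {μ : Measure X}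
    [NormedAddCommGroup V] [NormedSpace ℂ V] [CompleteSpace V] {E : Submodule ℂ V}
    (hE : IsClosed (E : Set V)) {f : X → V} (hf : Integrable f μ) (hfE : ∀ x, f x ∈ E) :
    ∫ x, f x ∂μ ∈ E := by
  have : IsClosed (E : Set V) := hE
  rw [← Submodule.Quotient.mk_eq_zero]
  have h := E.mkQL.integral_comp_comm hf
  have h0 : ∀ x, E.mkQL (f x) = 0 := fun x => (Submodule.Quotient.mk_eq_zero E).2 (hfE x)
  simp_rw [h0, integral_zero] at h
  exact h.symm

/-- Each weak derivative identity equates two continuous functionals, and these commute with the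
Bochner integral. Points with `χ x = 0` are exempt because far translates need not be jets. -/
theorem isWeakJet_integral {X : Type*} [MeasurableSpace X] {μ : Measure X}
    {χ : X → ℂ} {f : X → IntervalJets a b s p} (hf : Integrable (fun x => χ x • f x) μ)
    (hfw : ∀ x, χ x ≠ 0 → IsWeakJet (f x)) : IsWeakJet (∫ x, χ x • f x ∂μ) := by
  intro j ψ h1 h2 h3
  obtain ⟨Λ, hΛ⟩ := exists_clm_integral_test_smul (a := a) (b := b) (p := p)
    (h1.continuous_iteratedDeriv j (by exact_mod_cast le_top))
  obtain ⟨Λ', hΛ'⟩ := exists_clm_integral_test_smul (a := a) (b := b) (p := p) h1.continuous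
  rw [← hΛ, ← hΛ']
  have e0 := (Λ.comp (ContinuousLinearMap.proj (R := ℂ)
    (φ := fun _ : Fin (s + 1) => Lp ℂ p (volume.restrict (Ioo a b))) 0)).integral_comp_comm hf
  have e1 := (Λ'.comp (ContinuousLinearMap.proj (R := ℂ)
    (φ := fun _ : Fin (s + 1) => Lp ℂ p (volume.restrict (Ioo a b))) j)).integral_comp_comm hf
  simp only [ContinuousLinearMap.comp_apply, ContinuousLinearMap.proj_apply] at e0 e1
  rw [← e0, ← e1, ← integral_const_mul]
  congr 1; funext x
  by_cases hx : χ x = 0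
  · simp [hx]
  rw [Pi.smul_apply, Pi.smul_apply, map_smul, map_smul, hΛ, hΛ', hfw x hx j ψ h1 h2 h3,
    smul_eq_mul, smul_eq_mul, mul_left_comm]

/-! ### Averages over the bias. -/

/-- Translation of `L^p` functions on the line followed by restriction to an interval. -/
noncomputable def translateRestrict (a b : ℝ) (p : ℝ≥0∞) [Fact (1 ≤ p)] (x : ℝ)
    (f : Lp ℂ p (volume : Measure ℝ)) : Lp ℂ p (volume.restrict (Ioo a b)) :=
  LpToLpRestrictCLM ℝ ℂ ℂ volume p (Ioo a b) (DomAddAct.mk x +ᵥ f)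

theorem translateRestrict_coeFn (x : ℝ) (f : Lp ℂ p (volume : Measure ℝ)) :
    translateRestrict a b p x f =ᵐ[volume.restrict (Ioo a b)] fun t => f (x + t) := by
  refine (LpToLpRestrictCLM_coeFn ℂ _ _).trans (ae_restrict_of_ae ?_)
  exact DomAddAct.vadd_Lp_ae_eq (DomAddAct.mk x) f

/-- Continuity of translation in `L^p`, which makes the averages Bochner integrals; it fails for `p
= ∞`. -/
theorem continuous_translateRestrict (hp : p ≠ ⊤) (f : Lp ℂ p (volume : Measure ℝ)) :
    Continuous fun x => translateRestrict a b p x f := by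
  have : Fact (p ≠ ⊤) := ⟨hp⟩
  have h : Continuous fun x : ℝ => (DomAddAct.mk x +ᵥ f : Lp ℂ p (volume : Measure ℝ)) :=
    (DomAddAct.continuous_mk).vadd continuous_const
  exact (LpToLpRestrictCLM ℝ ℂ ℂ volume p (Ioo a b)).continuous.comp h

theorem map_affine_volume {κ : ℝ} (hκ : κ ≠ 0) (ν : ℝ) :
    Measure.map (fun y => κ * y + ν) volume = ENNReal.ofReal |κ⁻¹| • volume := by
  have : (fun y => κ * y + ν) = (fun y => y + ν) ∘ (fun y => κ * y) := rfl
  rw [this, ← Measure.map_map (measurable_add_const ν) (measurable_const_mul κ),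
    Real.map_volume_mul_left hκ, Measure.map_smul, map_add_right_eq_self]

theorem quasiMeasurePreserving_affine {κ : ℝ} (hκ : κ ≠ 0) (ν : ℝ) :
    Measure.QuasiMeasurePreserving (fun y : ℝ => κ * y + ν) volume volume :=
  ⟨(measurable_const_mul κ).add_const ν, by
    rw [map_affine_volume hκ]; exact Measure.smul_absolutelyContinuous⟩

/-- A function all of whose affine pullbacks to one interval have weak derivatives in `L^p`
there has weak derivatives in `L^p` of any bounded interval. -/
theorem exists_global_jet (hab : a < b) {σ : ℝ → ℂ}
    (h : ∀ W c : ℝ, W ≠ 0 → ∃ w : IntervalJets a b s p, IsWeakJet w ∧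
      w 0 =ᵐ[volume.restrict (Ioo a b)] fun t => σ (W * t + c))
    {W : ℝ} (hW : W ≠ 0) (c : ℝ) {A B : ℝ} (hAB : A < B) :
    ∃ H : Fin (s + 1) → Lp ℂ p (volume : Measure ℝ),
      (H 0 =ᵐ[volume.restrict (Ioo A B)] fun t => σ (W * t + c)) ∧
      ∀ j : Fin (s + 1), IsWeakDeriv (Ioo A B) j (H 0) (H j) := by
  set κ : ℝ := (b - a) / (B - A) with hκ
  have hκ0 : 0 < κ := div_pos (sub_pos.2 hab) (sub_pos.2 hAB)
  set ν : ℝ := a - κ * A with hν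
  have hT : ∀ y ∈ Ioo A B, κ * y + ν ∈ Ioo a b := by
    intro y hy
    have hB : κ * (B - A) = b - a := div_mul_cancel₀ _ (sub_pos.2 hAB).ne'
    constructor
    · nlinarith [mul_pos hκ0 (sub_pos.2 hy.1)]
    · nlinarith [mul_pos hκ0 (sub_pos.2 hy.2)]
  -- The affine map `κ y + ν` carries `(A, B)` onto `(a, b)`; these parameters make the composition
  -- with it equal to `σ (W y + c)`.
  obtain ⟨w, hw, hw0⟩ := h (W / κ) (c - W / κ * ν) (div_ne_zero hW hκ0.ne')
  set F : Fin (s + 1) → ℝ → ℂ := fun j y =>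
    (κ : ℂ) ^ (j : ℕ) * (Ioo a b).indicator (w j) (κ * y + ν) with hF
  have hFm : ∀ j, MemLp (F j) p volume := by
    intro j
    have h1 : MemLp ((Ioo a b).indicator (w j)) p volume :=
      (memLp_indicator_iff_restrict measurableSet_Ioo).2 (Lp.memLp (w j))
    have h2 : MemLp ((Ioo a b).indicator (w j)) p (Measure.map (fun y => κ * y + ν) volume) := by
      rw [map_affine_volume hκ0.ne']
      exact h1.smul_measure ENNReal.ofReal_ne_top
    exact (h2.comp_of_map (by fun_prop)).const_mul _
  have hFc : ∀ j, (hFm j).toLp (F j) =ᵐ[volume.restrict (Ioo A B)]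
      fun y => (κ : ℂ) ^ (j : ℕ) * w j (κ * y + ν) := by
    intro j
    filter_upwards [ae_restrict_of_ae (hFm j).coeFn_toLp, ae_restrict_mem measurableSet_Ioo]
      with y hy hyU
    rw [hy, hF]
    simp only [indicator_of_mem (hT y hyU)]
  refine ⟨fun j => (hFm j).toLp (F j), ?_, fun j => ?_⟩
  · refine (hFc 0).trans ?_
    have := (quasiMeasurePreserving_affine hκ0.ne' ν).ae
      ((ae_restrict_iff' measurableSet_Ioo).1 hw0)
    filter_upwards [ae_restrict_of_ae this, ae_restrict_mem measurableSet_Ioo] with y hy hyU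
    simp only [Fin.val_zero, pow_zero, one_mul]
    rw [hy (hT y hyU)]
    congr 1
    field_simp
    ring
  · refine ((hw j).comp_affine hκ0.ne' ν hT).congr ?_ (hFc j).symm
    refine EventuallyEq.trans ?_ (hFc 0).symm
    exact ae_of_all _ fun y => by simp

/-- A closed space of jets that contains the jets of all `σ (W · + c)`, `W ≠ 0`, contains the jets
of their averages over the bias. -/
theorem smoothJet_average_mem (hab : a < b) (hp : p ≠ ⊤) {E : Submodule ℂ (IntervalJets a b s p)}
    (hE : IsClosed (E : Set (IntervalJets a b s p))) {σ : ℝ → ℂ} (hσm : Measurable σ) {K : ℝ}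
    (hσK : ∀ t, ‖σ t‖ ≤ K)
    (h : ∀ W c : ℝ, W ≠ 0 → ∃ w ∈ E, IsWeakJet w ∧
      w 0 =ᵐ[volume.restrict (Ioo a b)] fun t => σ (W * t + c))
    {W : ℝ} (hW : W ≠ 0) (c : ℝ) {χ : ℝ → ℝ} (hχ : Continuous χ) (hχc : HasCompactSupport χ)
    {g : ℝ → ℂ} (hg : ContDiff ℝ ∞ g) (hgχ : ∀ t, g t = ∫ x, χ x • σ (W * t + c + W * x)) :
    smoothJet a b s p hg ∈ E := by
  obtain ⟨r, hr0, hr⟩ : ∃ r, 0 < r ∧ ∀ x, χ x ≠ 0 → |x| < r := by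
    obtain ⟨r, hr⟩ := hχc.isCompact.isBounded.exists_norm_le
    refine ⟨|r| + 1, by positivity, fun x hx => ?_⟩
    have := hr x (subset_tsupport _ hx)
    rw [Real.norm_eq_abs] at this
    linarith [le_abs_self r]
  -- The interval is enlarged by the radius of the support of `χ`, so that all translates in the
  -- average are jets on `(a, b)`.
  obtain ⟨H, hH0, hH⟩ := exists_global_jet hab (fun W c hW => by
    obtain ⟨w, -, hw⟩ := h W c hW
    exact ⟨w, hw⟩) hW c (A := a - r) (B := b + r) (by linarith)
  set J : ℝ → IntervalJets a b s p := fun x j => translateRestrict a b p x (H j) with hJ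
  have hmaps : ∀ x, χ x ≠ 0 → ∀ t ∈ Ioo a b, 1 * t + x ∈ Ioo (a - r) (b + r) := by
    intro x hx t ht
    have := abs_lt.1 (hr x hx)
    constructor <;> linarith [ht.1, ht.2, this.1, this.2]
  have hJ0 : ∀ x, χ x ≠ 0 → J x 0 =ᵐ[volume.restrict (Ioo a b)]
      fun t => σ (W * t + c + W * x) := by
    intro x hx
    refine (translateRestrict_coeFn x (H 0)).trans ?_
    have := (quasiMeasurePreserving_affine one_ne_zero x).ae
      ((ae_restrict_iff' measurableSet_Ioo).1 hH0)
    filter_upwards [ae_restrict_of_ae this, ae_restrict_mem measurableSet_Ioo] with t ht htU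
    rw [show x + t = 1 * t + x by ring, ht (hmaps x hx t htU)]
    congr 1; ring
  have hJw : ∀ x, χ x ≠ 0 → IsWeakJet (J x) := by
    intro x hx j
    refine ((hH j).comp_affine one_ne_zero x (hmaps x hx)).congr ?_ ?_
    · filter_upwards [translateRestrict_coeFn (a := a) (b := b) x (H 0)] with t ht
      rw [hJ, ht]; congr 1; ring
    · filter_upwards [translateRestrict_coeFn (a := a) (b := b) x (H j)] with t ht
      rw [hJ, ht, Complex.ofReal_one, one_pow, one_mul]; congr 1; ring
  have hJE : ∀ x, χ x ≠ 0 → J x ∈ E := by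
    intro x hx
    -- A shift by `x` changes the bias by `W * x`; uniqueness identifies the translate with the jet
    -- known to lie in `E`.
    obtain ⟨w, hwE, hw, hw0⟩ := h W (c + W * x) hW
    have : J x = w := by
      refine (hJw x hx).ext hw ((hJ0 x hx).trans (EventuallyEq.symm ?_))
      filter_upwards [hw0] with t ht
      rw [ht, add_assoc]
    exact this ▸ hwE
  have hJc : Continuous J := continuous_pi fun j => continuous_translateRestrict hp (H j)
  have hi : Integrable (fun x => (χ x : ℂ) • J x) :=
    ((Complex.continuous_ofReal.comp hχ).smul hJc).integrable_of_hasCompactSupport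
      (hχc.comp_left (g := ((↑) : ℝ → ℂ)) Complex.ofReal_zero).smul_right
  have hIE : ∫ x, (χ x : ℂ) • J x ∈ E := by
    refine integral_mem_of_isClosed hE hi fun x => ?_
    by_cases hx : χ x = 0
    · rw [hx, Complex.ofReal_zero, zero_smul]; exact E.zero_mem
    · exact E.smul_mem _ (hJE x hx)
  have hIw : IsWeakJet (∫ x, (χ x : ℂ) • J x) :=
    isWeakJet_integral hi fun x hx => hJw x (by simpa using hx)
  rw [(isWeakJet_smoothJet hg).ext hIw ?_]
  · exact hIE
  -- Only the functions remain to be compared. Against a test function, Fubini interchanges the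
  -- integrals in `t` and in the shift `x`.
  refine ae_eq_of_forall_test isOpen_Ioo (integrableOn_Lp _) (integrableOn_Lp _)
    fun ψ h1 h2 h3 => ?_
  obtain ⟨Λ, hΛ⟩ := exists_clm_integral_test_smul (a := a) (b := b) (p := p) h1.continuous
  have e0 := (Λ.comp (ContinuousLinearMap.proj (R := ℂ)
    (φ := fun _ : Fin (s + 1) => Lp ℂ p (volume.restrict (Ioo a b))) 0)).integral_comp_comm hi
  simp only [ContinuousLinearMap.comp_apply, ContinuousLinearMap.proj_apply] at e0
  rw [← hΛ ((∫ x, (χ x : ℂ) • J x) 0), ← e0]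
  have e1 : ∀ x, Λ (((χ x : ℂ) • J x) 0) =
      ∫ t in Ioo a b, ψ t • χ x • σ (W * t + c + W * x) := by
    intro x
    by_cases hx : χ x = 0
    · simp [hx]
    · rw [Pi.smul_apply, map_smul, hΛ, ← integral_smul]
      refine integral_congr_ae ?_
      filter_upwards [hJ0 x hx] with t ht
      rw [ht, Complex.coe_smul, smul_comm]
  simp_rw [e1]
  rw [integral_integral_swap]
  · refine integral_congr_ae ?_
    filter_upwards [smoothJet_coeFn (a := a) (b := b) (s := s) (p := p) hg 0] with t ht
    rw [ht, integral_smul, ← hgχ]; simp [iteratedDeriv_zero]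
  · have i1 : Integrable (fun z : ℝ × ℝ => χ z.1 * ψ z.2)
        (volume.prod (volume.restrict (Ioo a b))) :=
      (hχ.integrable_of_hasCompactSupport hχc).mul_prod
        (h1.continuous.integrable_of_hasCompactSupport h2)
    have i2 := Integrable.smul_bdd i1 K (hσm.comp (by fun_prop : Measurable fun z : ℝ × ℝ =>
      W * z.2 + c + W * z.1)).aestronglyMeasurable (ae_of_all _ fun z => hσK _)
    refine i2.congr (ae_of_all _ fun z => ?_)
    change (χ z.1 * ψ z.2) • σ _ = ψ z.2 • χ z.1 • σ _
    rw [smul_smul, mul_comm]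

/-! ### Polynomials as limits of dilations. -/

theorem smoothJet_add {g h : ℝ → ℂ} (hg : ContDiff ℝ ∞ g) (hh : ContDiff ℝ ∞ h) :
    smoothJet a b s p (hg.add hh) = smoothJet a b s p hg + smoothJet a b s p hh := by
  funext j
  refine Lp.ext ?_
  rw [Pi.add_apply]
  filter_upwards [smoothJet_coeFn (a := a) (b := b) (p := p) (hg.add hh) j,
    smoothJet_coeFn (a := a) (b := b) (p := p) hg j,
    smoothJet_coeFn (a := a) (b := b) (p := p) hh j,
    Lp.coeFn_add (smoothJet a b s p hg j) (smoothJet a b s p hh j)] with t h1 h2 h3 h4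
  rw [h1, h4, Pi.add_apply, h2, h3]
  exact iteratedDeriv_add (hg.of_le (by exact_mod_cast le_top)).contDiffAt
    (hh.of_le (by exact_mod_cast le_top)).contDiffAt

theorem smoothJet_smul {g : ℝ → ℂ} (c : ℂ) (hg : ContDiff ℝ ∞ g) :
    smoothJet a b s p (g := fun t => c • g t) (hg.const_smul c) = c • smoothJet a b s p hg := by
  funext j
  refine Lp.ext ?_
  rw [Pi.smul_apply]
  filter_upwards [smoothJet_coeFn (a := a) (b := b) (p := p)
      (g := fun t => c • g t) (hg.const_smul c) j,
    smoothJet_coeFn (a := a) (b := b) (p := p) hg j,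
    Lp.coeFn_smul c (smoothJet a b s p hg j)] with t h1 h2 h3
  rw [h1, h3, Pi.smul_apply, h2]
  exact iteratedDeriv_const_smul (hg.of_le (by exact_mod_cast le_top)).contDiffAt c

theorem smoothJet_congr {g h : ℝ → ℂ} (hg : ContDiff ℝ ∞ g) (hh : ContDiff ℝ ∞ h)
    (e : ∀ t, g t = h t) : smoothJet a b s p hg = smoothJet a b s p hh := by
  obtain rfl : g = h := funext e
  rfl

/-- The jet of a polynomial. -/
noncomputable def polyJet (a b : ℝ) (s : ℕ) (p : ℝ≥0∞) [Fact (1 ≤ p)] :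
    Polynomial ℂ →ₗ[ℂ] IntervalJets a b s p where
  toFun P := smoothJet a b s p (contDiff_polynomial_ofReal P)
  map_add' P Q := by
    rw [← smoothJet_add]
    exact smoothJet_congr _ _ fun t => Polynomial.eval_add
  map_smul' c P := by
    rw [RingHom.id_apply, ← smoothJet_smul]
    exact smoothJet_congr _ _ fun t => Polynomial.eval_smul _ _ _

theorem norm_smoothJet_le {g : ℝ → ℂ} (hg : ContDiff ℝ ∞ g) (j : Fin (s + 1)) {δ : ℝ}
    (hδ : 0 ≤ δ) (h : ∀ t ∈ Ioo a b, ‖iteratedDeriv j g t‖ ≤ δ) :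
    ‖smoothJet a b s p hg j‖ ≤ measureUnivNNReal (volume.restrict (Ioo a b)) ^ p.toReal⁻¹ * δ := by
  refine Lp.norm_le_of_ae_bound hδ ?_
  filter_upwards [smoothJet_coeFn (a := a) (b := b) (p := p) hg j,
    ae_restrict_mem measurableSet_Ioo] with t h1 h2
  rw [h1]
  exact h t h2

/-- Taylor's formula of order `m - j` for the `j`th derivative, whose Taylor polynomial at `0`
vanishes. -/
theorem isLittleO_iteratedDeriv_of_forall_eq_zero {r : ℝ → ℂ} (hr : ContDiff ℝ ∞ r) {m : ℕ}
    (h0 : ∀ i ≤ m, iteratedDeriv i r 0 = 0) {j : ℕ} (hj : j ≤ m) :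
    iteratedDeriv j r =o[𝓝 0] fun y : ℝ => y ^ (m - j) := by
  have hrj : ContDiff ℝ (m - j : ℕ) (iteratedDeriv j r) :=
    iteratedDeriv_eq_iterate (f := r) ▸ (contDiff_infty.1 hr (m - j + j)).iterate_deriv' _ _
  have := taylor_isLittleO_univ (x₀ := 0) hrj
  simp only [sub_zero] at this
  refine this.congr_left fun y => ?_
  rw [taylor_within_apply, Finset.sum_eq_zero, sub_zero]
  intro i hi
  have e : iteratedDeriv i (iteratedDeriv j r) 0 = iteratedDeriv (i + j) r 0 := by
    simp only [iteratedDeriv_eq_iterate, Function.iterate_add_apply]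
  rw [iteratedDerivWithin_univ, e, h0 _ (by have := Finset.mem_range.1 hi; omega), smul_zero]

/-- The left side is the `j`th derivative of `r (W ·)`, so `W⁻ᵐ r (W ·)` tends to zero with all
derivatives. For `j ≤ m` this is Taylor; for `j > m` the spare factor `W` suffices. -/
theorem exists_pow_mul_norm_iteratedDeriv_le {r : ℝ → ℂ} (hr : ContDiff ℝ ∞ r) {m : ℕ}
    (h0 : ∀ i ≤ m, iteratedDeriv i r 0 = 0) (j : ℕ) {L : ℝ} (hL : 0 < L) {ε : ℝ} (hε : 0 < ε) :
    ∀ᶠ W in 𝓝[>] (0 : ℝ), ∀ t, |t| ≤ L → W ^ j * ‖iteratedDeriv j r (W * t)‖ ≤ ε * W ^ m := by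
  have hsmall : ∀ δ > 0, ∀ᶠ W in 𝓝[>] (0 : ℝ), 0 < W ∧ ∀ t, |t| ≤ L → |W * t| < δ := by
    intro δ hδ
    have : Ioo (0 : ℝ) (δ / L) ∈ 𝓝[>] (0 : ℝ) := Ioo_mem_nhdsGT (div_pos hδ hL)
    filter_upwards [this] with W hW
    refine ⟨hW.1, fun t ht => ?_⟩
    rw [abs_mul, abs_of_pos hW.1]
    calc W * |t| ≤ W * L := mul_le_mul_of_nonneg_left ht hW.1.le
      _ < δ := (lt_div_iff₀ hL).1 hW.2
  rcases le_or_gt j m with hj | hj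
  · have h1 := (isLittleO_iteratedDeriv_of_forall_eq_zero hr h0 hj).def
      (c := ε / L ^ (m - j)) (by positivity)
    obtain ⟨δ, hδ, hδ'⟩ := Metric.eventually_nhds_iff.1 h1
    filter_upwards [hsmall δ hδ] with W ⟨hW, hWt⟩ t ht
    have h2 := hδ' (y := W * t) (by rw [Real.dist_eq, sub_zero]; exact hWt t ht)
    rw [norm_pow, Real.norm_eq_abs, abs_mul, abs_of_pos hW] at h2
    calc W ^ j * ‖iteratedDeriv j r (W * t)‖
        ≤ W ^ j * (ε / L ^ (m - j) * (W * L) ^ (m - j)) := by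
          refine mul_le_mul_of_nonneg_left (h2.trans ?_) (by positivity)
          gcongr
      _ = ε * (W ^ j * W ^ (m - j)) := by
          rw [mul_pow]; field_simp
      _ = ε * W ^ m := by rw [← pow_add, Nat.add_sub_cancel' hj]
  · obtain ⟨K, hK⟩ := (isCompact_Icc (a := (-1 : ℝ)) (b := 1)).exists_bound_of_continuousOn
      (hr.continuous_iteratedDeriv j (by exact_mod_cast le_top)).continuousOn
    have hK0 : 0 ≤ K := (norm_nonneg _).trans (hK 0 (by simp))
    have h3 : Ioo (0 : ℝ) (min 1 (ε / (K + 1))) ∈ 𝓝[>] (0 : ℝ) :=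
      Ioo_mem_nhdsGT (lt_min one_pos (by positivity))
    filter_upwards [hsmall 1 one_pos, h3] with W ⟨hW, hWt⟩ hW' t ht
    have h4 := hK (W * t) (abs_le.1 (hWt t ht).le)
    have h5 : W * (K + 1) ≤ ε :=
      ((lt_div_iff₀ (by positivity)).1 (hW'.2.trans_le (min_le_right _ _))).le
    have h6 : W ≤ 1 := (hW'.2.trans_le (min_le_left _ _)).le
    calc W ^ j * ‖iteratedDeriv j r (W * t)‖ ≤ W ^ (m + 1) * K := by
          refine mul_le_mul (pow_le_pow_of_le_one hW.le h6 hj) h4 (norm_nonneg _) (by positivity)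
      _ = (W * K) * W ^ m := by ring
      _ ≤ ε * W ^ m := by
          refine mul_le_mul_of_nonneg_right ?_ (by positivity)
          nlinarith

open Polynomial in
/-- The jets of all dilations and translations of a smooth function with no derivative vanishing
identically generate the jets of the polynomials. -/
theorem polyJet_mem {E : Submodule ℂ (IntervalJets a b s p)}
    (hE : IsClosed (E : Set (IntervalJets a b s p))) {τ : ℝ → ℂ} (hτ : ContDiff ℝ ∞ τ)
    (hτm : ∀ m, ∃ t, iteratedDeriv m τ t ≠ 0)
    (h : ∀ W c : ℝ, 0 < W → ∀ hg : ContDiff ℝ ∞ (fun t => τ (W * t + c)),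
      smoothJet a b s p hg ∈ E) (P : ℂ[X]) : polyJet a b s p P ∈ E := by
  have hX : ∀ m : ℕ, polyJet a b s p (X ^ m) ∈ E := by
    intro m
    induction m using Nat.strong_induction_on with
    | _ m ih =>
    obtain ⟨c, hc⟩ := hτm m
    set α : ℕ → ℂ := fun i => iteratedDeriv i τ c / (i.factorial : ℂ) with hα
    have hα0 : α m ≠ 0 := div_ne_zero hc (by exact_mod_cast m.factorial_ne_zero)
    set T : ℂ[X] := ∑ i ∈ Finset.range (m + 1), α i • X ^ i with hT
    set r : ℝ → ℂ := fun y => τ (y + c) - T.eval (y : ℂ) with hr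
    have hτc : ContDiff ℝ ∞ fun y => τ (y + c) := hτ.comp (contDiff_id.add contDiff_const)
    have hrs : ContDiff ℝ ∞ r := hτc.sub (contDiff_polynomial_ofReal T)
    have hr0 : ∀ i ≤ m, iteratedDeriv i r 0 = 0 := by
      intro i hi
      have e := iteratedDeriv_sub (n := i) (x := (0 : ℝ)) (f := fun y => τ (y + c))
        (g := fun y : ℝ => T.eval (y : ℂ)) (hτc.of_le (by exact_mod_cast le_top)).contDiffAt
        ((contDiff_polynomial_ofReal T).of_le (by exact_mod_cast le_top)).contDiffAt
      refine e.trans ?_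
      rw [iteratedDeriv_comp_add_const, iteratedDeriv_polynomial_ofReal]
      simp only [zero_add, Complex.ofReal_zero]
      rw [← coeff_zero_eq_eval_zero, coeff_iterate_derivative, zero_add, Nat.descFactorial_self,
        hT, finsetSum_coeff]
      simp only [coeff_smul, coeff_X_pow, smul_eq_mul, mul_ite, mul_one, mul_zero]
      rw [Finset.sum_ite_eq, if_pos (Finset.mem_range.2 (by omega)), hα, nsmul_eq_mul,
        mul_div_cancel₀, sub_self]
      exact_mod_cast i.factorial_ne_zero
    have hrW : ∀ W : ℝ, ContDiff ℝ ∞ fun t => r (W * t) := fun W =>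
      hrs.comp (contDiff_const.mul contDiff_id)
    have hτW : ∀ W : ℝ, ContDiff ℝ ∞ fun t => τ (W * t + c) := fun W =>
      hτc.comp (contDiff_const.mul contDiff_id)
    -- The Taylor terms of `τ (W t + c)` of degree below `m`, in `E` by induction. Once they are
    -- removed, division by `W ^ m` leaves `α m t^m` plus a vanishing remainder.
    set T' : ℝ → ℂ[X] := fun W => ∑ i ∈ Finset.range m, (α i * (W : ℂ) ^ i) • X ^ i with hT'
    have hdec : ∀ W : ℝ, smoothJet a b s p (hτW W) - polyJet a b s p (T' W) =
        smoothJet a b s p (hrW W) + ((W : ℂ) ^ m) • polyJet a b s p (α m • X ^ m) := by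
      intro W
      rw [sub_eq_iff_eq_add, add_assoc, ← map_smul, ← map_add]
      change _ = smoothJet a b s p (hrW W) + smoothJet a b s p (contDiff_polynomial_ofReal _)
      rw [← smoothJet_add]
      refine smoothJet_congr _ _ fun t => ?_
      simp only [hr, hT, hT', eval_add, eval_finsetSum, eval_smul, eval_pow, eval_X, smul_eq_mul,
        Finset.sum_range_succ, Complex.ofReal_mul, mul_pow]
      have : ∀ i, α i * ((W : ℂ) ^ i * (t : ℂ) ^ i) = α i * (W : ℂ) ^ i * (t : ℂ) ^ i :=
        fun i => by ring
      simp only [this]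
      ring
    have hlim : Tendsto (fun W : ℝ => ((W : ℂ) ^ m)⁻¹ • (smoothJet a b s p (hτW W) -
        polyJet a b s p (T' W))) (𝓝[>] 0) (𝓝 (polyJet a b s p (α m • X ^ m))) := by
      rw [tendsto_pi_nhds]
      intro j
      rw [Metric.tendsto_nhds]
      intro ε hε
      set κ : ℝ := measureUnivNNReal (volume.restrict (Ioo a b)) ^ p.toReal⁻¹ with hκ
      have hκ0 : 0 ≤ κ := by positivity
      have hε' : 0 < ε / (κ + 1) := by positivity
      filter_upwards [exists_pow_mul_norm_iteratedDeriv_le hrs hr0 j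
        (L := |a| + |b| + 1) (by positivity) hε', self_mem_nhdsWithin] with W hW hW0
      have hW0' : (0 : ℝ) < W := hW0
      have hWm : ((W : ℂ) ^ m) ≠ 0 := pow_ne_zero _ (by exact_mod_cast hW0'.ne')
      rw [hdec, smul_add, inv_smul_smul₀ hWm, dist_eq_norm, Pi.add_apply, add_sub_cancel_right,
        Pi.smul_apply, norm_smul]
      have hb := norm_smoothJet_le (a := a) (b := b) (s := s) (p := p) (hrW W) j
        (δ := ε / (κ + 1) * W ^ m) (by positivity) (fun t ht => by
          rw [iteratedDeriv_comp_const_smul (hrs.of_le (by exact_mod_cast le_top)), norm_smul,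
            norm_pow, Real.norm_eq_abs, abs_of_pos hW0']
          refine hW t ?_
          rw [abs_le]
          constructor
          · linarith [ht.1, neg_abs_le a, abs_nonneg b]
          · linarith [ht.2, le_abs_self b, abs_nonneg a])
      rw [norm_inv, norm_pow, Complex.norm_real, Real.norm_eq_abs, abs_of_pos hW0']
      calc (W ^ m)⁻¹ * ‖smoothJet a b s p (hrW W) j‖
          ≤ (W ^ m)⁻¹ * (κ * (ε / (κ + 1) * W ^ m)) :=
            mul_le_mul_of_nonneg_left hb (by positivity)
        _ = κ / (κ + 1) * ε := by field_simp
        _ < 1 * ε := by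
            refine mul_lt_mul_of_pos_right ?_ hε
            rw [div_lt_one (by positivity)]
            linarith
        _ = ε := one_mul ε
    have hmem : polyJet a b s p (α m • X ^ m) ∈ E := by
      refine hE.mem_of_tendsto hlim ?_
      filter_upwards [self_mem_nhdsWithin] with W hW
      refine E.smul_mem _ (E.sub_mem (h W c hW _) ?_)
      rw [hT', map_sum]
      refine E.sum_mem fun i hi => ?_
      rw [map_smul]
      exact E.smul_mem _ (ih i (Finset.mem_range.1 hi))
    rw [map_smul] at hmem
    exact (E.smul_mem_iff hα0).1 hmem
  rw [P.as_sum_range_C_mul_X_pow, map_sum]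
  refine E.sum_mem fun i _ => ?_
  rw [← smul_eq_C_mul, map_smul]
  exact E.smul_mem _ (hX i)

/-- Weak jets are limits of jets of polynomials. -/
theorem mem_of_polyJet_mem (hab : a < b) (hp : p ≠ ⊤) {E : Submodule ℂ (IntervalJets a b s p)}
    (hE : IsClosed (E : Set (IntervalJets a b s p))) (h : ∀ P, polyJet a b s p P ∈ E)
    {w : IntervalJets a b s p} (hw : IsWeakJet w) : w ∈ E := by
  rw [← SetLike.mem_coe, ← hE.closure_eq, Metric.mem_closure_iff]
  intro ε hε
  set v : ℕ → ℝ → ℂ := fun j => if hj : j < s + 1 then w ⟨j, hj⟩ else 0 with hv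
  have hvj : ∀ j (hj : j < s + 1), v j = w ⟨j, hj⟩ := fun j hj => dif_pos hj
  obtain ⟨P, hP⟩ := exists_polynomial_eLpNorm_iterate_derivative_sub_le hab Fact.out hp s v
    (fun j hj => by rw [hvj j (by omega)]; exact Lp.memLp _)
    (fun j hj => by
      rw [hvj j (by omega), hvj (j + 1) (by omega)]
      exact (hw ⟨j, by omega⟩).succ_of (hw ⟨j + 1, by omega⟩))
    (ENNReal.ofReal (ε / 2)) (by simpa using hε)
  refine ⟨polyJet a b s p P, h P, ?_⟩
  refine lt_of_le_of_lt ((dist_pi_le_iff (by positivity)).2 fun j => ?_) (half_lt_self hε)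
  rw [dist_comm, Lp.dist_def]
  refine ENNReal.toReal_le_of_le_ofReal (by positivity) (le_trans (le_of_eq ?_) (hP j (by omega)))
  refine eLpNorm_congr_ae ?_
  filter_upwards [smoothJet_coeFn (a := a) (b := b) (p := p) (contDiff_polynomial_ofReal P) j]
    with t ht
  rw [Pi.sub_apply, hvj j j.2, ← congrFun (iteratedDeriv_polynomial_ofReal P j) t, ← ht]
  rfl

/-- Density in the Sobolev space of an interval of the networks whose activation function is
bounded and not almost everywhere constant. -/
theorem mem_of_isWeakJet (hab : a < b) (hp : p ≠ ⊤) {E : Submodule ℂ (IntervalJets a b s p)}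
    (hE : IsClosed (E : Set (IntervalJets a b s p))) {σ : ℝ → ℂ} {K : ℝ}
    (hσK : ∀ t, ‖σ t‖ ≤ K) (hσ : ¬ ∃ c : ℂ, ∀ᵐ t : ℝ, σ t = c)
    (h : ∀ W c : ℝ, W ≠ 0 → ∃ w ∈ E, IsWeakJet w ∧
      w 0 =ᵐ[volume.restrict (Ioo a b)] fun t => σ (W * t + c))
    {w : IntervalJets a b s p} (hw : IsWeakJet w) : w ∈ E := by
  -- Measurability of `σ` comes from the jets: on each bounded interval `σ` agrees a.e. with an
  -- `L^p` function.
  have hσm : AEStronglyMeasurable σ volume := by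
    have hn : ∀ n : ℕ, AEStronglyMeasurable σ (volume.restrict (Ioo (-(n + 1 : ℝ)) (n + 1))) := by
      intro n
      obtain ⟨H, hH, -⟩ := exists_global_jet hab (fun W c hW => by
        obtain ⟨w, -, hw⟩ := h W c hW
        exact ⟨w, hw⟩) one_ne_zero 0 (A := -(n + 1 : ℝ)) (B := n + 1)
        (by linarith [(Nat.cast_nonneg n : (0 : ℝ) ≤ n)])
      simp only [one_mul, add_zero] at hH
      exact (Lp.aestronglyMeasurable (H 0)).restrict.congr hH
    have := aestronglyMeasurable_iUnion_iff.2 hn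
    rwa [show (⋃ n : ℕ, Ioo (-(n + 1 : ℝ)) (n + 1)) = univ from ?_, Measure.restrict_univ] at this
    refine eq_univ_of_forall fun t => mem_iUnion.2 ?_
    obtain ⟨n, hn⟩ := exists_nat_gt |t|
    exact ⟨n, abs_lt.1 (by linarith)⟩
  -- Averaging uses Fubini for a measurable function bounded everywhere, so a representative is set
  -- to zero where it exceeds `K`.
  obtain ⟨σ', hσ'm, hσ'K, hσσ'⟩ : ∃ σ' : ℝ → ℂ, Measurable σ' ∧ (∀ t, ‖σ' t‖ ≤ K) ∧
      σ =ᵐ[volume] σ' := by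
    have hm := hσm.stronglyMeasurable_mk.measurable
    have hS : MeasurableSet {t | ‖hσm.mk σ t‖ ≤ K} := measurableSet_le hm.norm measurable_const
    refine ⟨{t | ‖hσm.mk σ t‖ ≤ K}.indicator (hσm.mk σ), hm.indicator hS, fun t => ?_, ?_⟩
    · by_cases ht : ‖hσm.mk σ t‖ ≤ K
      · rwa [indicator_of_mem (by exact ht)]
      · rw [indicator_of_notMem (by exact ht), norm_zero]
        exact (norm_nonneg _).trans (hσK 0)
    · filter_upwards [hσm.ae_eq_mk] with t ht
      rw [indicator_of_mem (by rw [mem_ofPred_eq, ← ht]; exact hσK t), ht]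
  have h' : ∀ W c : ℝ, W ≠ 0 → ∃ w ∈ E, IsWeakJet w ∧
      w 0 =ᵐ[volume.restrict (Ioo a b)] fun t => σ' (W * t + c) := by
    intro W c hW
    obtain ⟨w, hwE, hw, hw0⟩ := h W c hW
    exact ⟨w, hwE, hw, hw0.trans
      (ae_restrict_of_ae ((quasiMeasurePreserving_affine hW c).ae hσσ'))⟩
  have hσ' : ¬ ∃ c : ℂ, ∀ᵐ t : ℝ, σ' t = c := by
    rintro ⟨c, hc⟩
    exact hσ ⟨c, hσσ'.trans hc⟩
  obtain ⟨χ, hχ, hχc, hτ, hτK, hτne⟩ := exists_average_not_const hσ'm hσ'K hσ'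
  refine mem_of_polyJet_mem hab hp hE (polyJet_mem hE hτ (fun m => ?_) fun W c hW hg => ?_) hw
  · by_contra hcon
    push Not at hcon
    exact hτne (eq_of_bounded_of_iteratedDeriv_eq_zero m _ hτ hτK hcon)
  -- The shift enters as `W * x`, so the rescaled weight `W χ(W x)` reproduces `τ (W t + c)` after
  -- substitution.
  · refine smoothJet_average_mem hab hp hE hσ'm hσ'K h' hW.ne' c (χ := fun x => W * χ (W * x))
      (by fun_prop) ?_ hg fun t => ?_
    · exact (hχc.comp_homeomorph (Homeomorph.mulLeft₀ W hW.ne')).mul_left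
    · have := Measure.integral_comp_mul_left (fun x => χ x • σ' (W * t + c + x)) W
      rw [abs_of_pos (inv_pos.2 hW)] at this
      simp_rw [mul_smul]
      rw [integral_smul, this, smul_inv_smul₀ hW.ne']

end Jets

/-! ### Concatenation and padding of networks. -/

/-- Side by side composition of two networks: their functions add up. -/
def Params.append {N n m : ℕ} (Θ : Params N n) (Θ' : Params N m) : Params N (n + m) where
  W k := Fin.append (Θ.W k) (Θ'.W k)
  b k := Fin.append (Θ.b k) (Θ'.b k)
  c k := Fin.append (Θ.c k) (Θ'.c k)

/-- The network with vanishing parameters. -/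
def Params.zero (N n : ℕ) : Params N n := ⟨0, 0, 0⟩

theorem network_append (σ : ℝ → ℂ) {N n m : ℕ} (Θ : Params N n) (Θ' : Params N m) (k : Fin N)
    (t : ℝ) : network σ (Θ.append Θ') k t = network σ Θ k t + network σ Θ' k t := by
  simp [network, Params.append, Fin.sum_univ_add]

theorem network_zero (σ : ℝ → ℂ) (N n : ℕ) (k : Fin N) (t : ℝ) :
    network σ (Params.zero N n) k t = 0 := by
  simp [network, Params.zero]

theorem norm_append_zero_le {V : Type*} [SeminormedAddCommGroup V] {n m : ℕ} (v : Fin n → V) :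
    ‖Fin.append v (0 : Fin m → V)‖ ≤ ‖v‖ := by
  refine (pi_norm_le_iff_of_nonneg (norm_nonneg _)).2 fun i => ?_
  refine Fin.addCases (fun i => ?_) (fun i => ?_) i
  · rw [Fin.append_left]; exact norm_le_pi_norm v i
  · rw [Fin.append_right, Pi.zero_apply, norm_zero]; exact norm_nonneg _

theorem Params.size_append_zero_le {N n : ℕ} (Θ : Params N n) (m : ℕ) :
    (Θ.append (Params.zero N m)).size ≤ Θ.size := by
  unfold Params.size
  refine ciSup_mono (Set.finite_range _).bddAbove fun k => ?_
  have hW : ‖(Θ.append (Params.zero N m)).W k‖ ≤ ‖Θ.W k‖ := by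
    rw [show (Θ.append (Params.zero N m)).W k = Fin.append (Θ.W k) 0 from rfl]
    exact norm_append_zero_le _
  have hb : ‖(Θ.append (Params.zero N m)).b k‖ ≤ ‖Θ.b k‖ := by
    rw [show (Θ.append (Params.zero N m)).b k = Fin.append (Θ.b k) 0 from rfl]
    exact norm_append_zero_le _
  have hc : ‖(Θ.append (Params.zero N m)).c k‖ ≤ ‖Θ.c k‖ := by
    rw [show (Θ.append (Params.zero N m)).c k = Fin.append (Θ.c k) 0 from rfl]
    exact norm_append_zero_le _
  linarith

/-! ### Density of networks in the broken Sobolev space. -/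

section BrokenSobolev

set_option linter.unusedSectionVars false

variable {N : ℕ} {x : Fin (N + 1) → ℝ} {s : ℕ} {p : ℝ≥0∞} [Fact (1 ≤ p)]

/-- The networks of arbitrary width inside the broken Sobolev space. -/
noncomputable def networks (σ : ℝ → ℂ) (x : Fin (N + 1) → ℝ) (s : ℕ) (p : ℝ≥0∞) [Fact (1 ≤ p)] :
    Submodule ℂ (brokenSobolev x s p) where
  carrier := {v | ∃ (n : ℕ) (Θ : Params N n), Represents v (network σ Θ)}
  zero_mem' := by
    refine ⟨0, Params.zero N 0, fun k => ?_⟩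
    filter_upwards [Lp.coeFn_zero ℂ p (volume.restrict (element x k))] with t ht
    rw [network_zero]
    exact ht
  add_mem' := by
    rintro v w ⟨n, Θ, h⟩ ⟨m, Θ', h'⟩
    refine ⟨n + m, Θ.append Θ', fun k => ?_⟩
    filter_upwards [h k, h' k, Lp.coeFn_add ((v : ElementJets x s p) (k, 0))
      ((w : ElementJets x s p) (k, 0))] with t h1 h2 h3
    rw [network_append, ← h1, ← h2]
    exact h3
  smul_mem' := by
    rintro a v ⟨n, Θ, h⟩
    refine ⟨n, ⟨Θ.W, Θ.b, a • Θ.c⟩, fun k => ?_⟩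
    filter_upwards [h k, Lp.coeFn_smul a ((v : ElementJets x s p) (k, 0))] with t h1 h2
    refine h2.trans ?_
    rw [Pi.smul_apply, h1]
    simp [network, Finset.mul_sum, mul_assoc]

/-- Every network belongs to `V^σ_{n,C_n}(𝒯_h)` for large `n`. -/
theorem eventually_mem_boundedNetworks {σ : ℝ → ℂ} {C : ℕ → ℝ} (hC : Tendsto C atTop atTop)
    {v : brokenSobolev x s p} (hv : v ∈ networks σ x s p) :
    ∀ᶠ n in atTop, v ∈ boundedNetworks σ x s p n (C n) := by
  obtain ⟨m, Θ, h⟩ := hv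
  filter_upwards [eventually_ge_atTop m, hC.eventually_gt_atTop Θ.size] with n hn hCn
  obtain ⟨l, rfl⟩ := Nat.exists_eq_add_of_le hn
  refine ⟨Θ.append (Params.zero N l), (Θ.size_append_zero_le l).trans_lt hCn, fun k => ?_⟩
  filter_upwards [h k] with t ht
  rw [network_append, network_zero, add_zero, ht]

/-- Extension by zero to the other elements. -/
noncomputable def extendJet (k : Fin N) :
    IntervalJets (x k.castSucc) (x k.succ) s p →ₗ[ℂ] ElementJets x s p :=
  (WithLp.linearEquiv p ℂ _).symm.toLinearMap ∘ₗ
    ∑ j : Fin (s + 1), (LinearMap.single ℂ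
      (fun i : Fin N × Fin (s + 1) => Lp ℂ p (volume.restrict (element x i.1))) (k, j)) ∘ₗ
        LinearMap.proj j

theorem extendJet_self (k : Fin N) (w : IntervalJets (x k.castSucc) (x k.succ) s p)
    (j : Fin (s + 1)) : extendJet k w (k, j) = w j := by
  simp only [extendJet, LinearMap.comp_apply, LinearMap.sum_apply]
  change (∑ i : Fin (s + 1), (Pi.single (k, i) (w i) :
    (i : Fin N × Fin (s + 1)) → Lp ℂ p (volume.restrict (element x i.1)))) (k, j) = w j
  rw [Finset.sum_apply, Finset.sum_eq_single j]
  · exact Pi.single_eq_same _ _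
  · intro i _ hi
    exact Pi.single_eq_of_ne (by simpa using hi.symm) _
  · simp

theorem extendJet_of_ne {k k' : Fin N} (hk : k' ≠ k)
    (w : IntervalJets (x k.castSucc) (x k.succ) s p) (j : Fin (s + 1)) :
    extendJet k w (k', j) = 0 := by
  simp only [extendJet, LinearMap.comp_apply, LinearMap.sum_apply]
  change (∑ i : Fin (s + 1), (Pi.single (k, i) (w i) :
    (i : Fin N × Fin (s + 1)) → Lp ℂ p (volume.restrict (element x i.1)))) (k', j) = 0
  rw [Finset.sum_apply]
  refine Finset.sum_eq_zero fun i _ => Pi.single_eq_of_ne (by simp [hk]) _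

theorem continuous_extendJet (k : Fin N) : Continuous (extendJet (x := x) (s := s) (p := p) k) := by
  refine (PiLp.continuous_toLp p _).comp (continuous_pi fun ⟨k', j⟩ => ?_)
  by_cases hk : k' = k
  · subst hk
    refine (continuous_apply j).congr fun w => ?_
    exact (extendJet_self k' w j).symm
  · refine (continuous_const (y := 0)).congr fun w => ?_
    exact (extendJet_of_ne hk w j).symm

/-- Weak derivatives are tested on each element separately, so nothing has to match at the nodes. -/
theorem extendJet_mem {k : Fin N} {w : IntervalJets (x k.castSucc) (x k.succ) s p}
    (hw : IsWeakJet w) : extendJet k w ∈ brokenSobolev x s p := by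
  intro k' j
  by_cases hk : k' = k
  · subst hk
    rw [extendJet_self, extendJet_self]
    exact hw j
  · rw [extendJet_of_ne hk, extendJet_of_ne hk]
    exact (brokenSobolev x s p).zero_mem k' j

theorem sum_extendJet (u : ElementJets x s p) :
    ∑ k, extendJet k (fun j => u (k, j)) = u := by
  ext1 ⟨k, j⟩
  rw [WithLp.ofLp_sum, Finset.sum_apply, Finset.sum_eq_single k]
  · exact extendJet_self k _ j
  · intro k' _ hk
    exact extendJet_of_ne hk.symm _ j
  · simp

/-- An element is the sum of its restrictions extended by zero. Pulling the closure of the networks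
back along `extendJet k` gives a closed space to which the density result on one interval applies.
-/
theorem dense_networks (hx : StrictMono x) (hp : p ≠ ⊤) {σ : ℝ → ℂ} {K : ℝ}
    (hσK : ∀ t, ‖σ t‖ ≤ K) (hσ : ¬ ∃ c : ℂ, ∀ᵐ t : ℝ, σ t = c)
    (hσs : ∀ (n : ℕ) (Θ : Params N n), ∃ v : brokenSobolev x s p, Represents v (network σ Θ)) :
    Dense (networks σ x s p : Set (brokenSobolev x s p)) := by
  intro u
  set D : Submodule ℂ (ElementJets x s p) :=
    ((networks σ x s p).map (brokenSobolev x s p).subtype).topologicalClosure with hD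
  have hDc : IsClosed (D : Set (ElementJets x s p)) := Submodule.isClosed_topologicalClosure _
  have key : ∀ k : Fin N, extendJet k (fun j => (u : ElementJets x s p) (k, j)) ∈ D := by
    intro k
    have hk : x k.castSucc < x k.succ := hx k.castSucc_lt_succ
    refine mem_of_isWeakJet (E := D.comap (extendJet k)) hk hp
      (hDc.preimage (continuous_extendJet k)) hσK hσ ?_ (fun j => u.2 k j)
    intro W c _
    -- One neuron, with output coefficient one on the `k`th element and zero elsewhere: its jet
    -- there, extended by zero, is represented by the same network.
    obtain ⟨v, hv⟩ := hσs 1 ⟨fun _ _ => W, fun _ _ => c, fun k' _ => if k' = k then 1 else 0⟩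
    obtain ⟨w, hw, hw0⟩ : ∃ w : IntervalJets (x k.castSucc) (x k.succ) s p, IsWeakJet w ∧
        w 0 =ᵐ[volume.restrict (element x k)] network σ
          ⟨fun _ _ => W, fun _ _ => c, fun k' (_ : Fin 1) => if k' = k then 1 else 0⟩ k :=
      ⟨fun j => (v : ElementJets x s p) (k, j), fun j => v.2 k j, hv k⟩
    refine ⟨w, ?_, hw, ?_⟩
    · refine Submodule.le_topologicalClosure _ ⟨⟨_, extendJet_mem hw⟩,
        ⟨1, ⟨fun _ _ => W, fun _ _ => c, fun k' _ => if k' = k then 1 else 0⟩, fun k' => ?_⟩, rfl⟩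
      by_cases hk' : k' = k
      · subst hk'
        rw [extendJet_self]
        exact hw0
      · rw [extendJet_of_ne hk']
        filter_upwards [Lp.coeFn_zero ℂ p (volume.restrict (element x k'))] with t ht
        rw [ht]
        simp [network, hk']
    · exact hw0.trans (ae_of_all _ fun t => by simp [network])
  have hu : (u : ElementJets x s p) ∈ D := by
    rw [← sum_extendJet (u : ElementJets x s p)]
    exact D.sum_mem fun k _ => key k
  rw [Topology.IsInducing.subtypeVal.closure_eq_preimage_closure_image]
  exact hu

end BrokenSobolev

/-! ### The loss functional and the conclusion. -/

section Loss

variable {N : ℕ} {V Y Z W : Type*} {Yk : Fin N → Type*}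
  [NormedAddCommGroup V] [NormedSpace ℂ V]
  [NormedAddCommGroup Y] [InnerProductSpace ℂ Y]
  [∀ k, NormedAddCommGroup (Yk k)] [∀ k, InnerProductSpace ℂ (Yk k)]
  [NormedAddCommGroup Z] [NormedSpace ℂ Z]
  [NormedAddCommGroup W] [NormedSpace ℂ W]
  (restr : Y ≃ₗᵢ[ℂ] PiLp 2 Yk) (φ : ∀ k, HilbertBasis ℕ ℂ (Yk k))
  (A : V →L[ℂ] Y) (f : Y) (B : V →L[ℂ] Z) (g : Z) (J₁ J₂ : V →L[ℂ] W)
  (τ : ℝ) (M : Fin N → ℕ)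

theorem continuous_truncatedLoss : Continuous (truncatedLoss restr φ A f B g J₁ J₂ τ M) := by
  have h : ∀ k, Continuous fun v => restr (A v - f) k := fun k =>
    (PiLp.continuous_apply 2 Yk k).comp (restr.continuous.comp (A.continuous.sub continuous_const))
  unfold truncatedLoss truncatedResidual
  refine .add (continuous_finsetSum _ fun k _ => continuous_finsetSum _ fun i _ =>
    (continuous_const.inner (h k)).norm.pow 2) ?_
  fun_prop

theorem truncatedLoss_nonneg (hτ : 0 ≤ τ) (v : V) :
    0 ≤ truncatedLoss restr φ A f B g J₁ J₂ τ M v := by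
  unfold truncatedLoss truncatedResidual
  positivity

theorem truncatedLoss_eq_zero {u : V} (hA : A u = f) (hB : B u = g) (h₁ : J₁ u = 0)
    (h₂ : J₂ u = 0) : truncatedLoss restr φ A f B g J₁ J₂ τ M u = 0 := by
  simp [truncatedLoss, truncatedResidual, hA, hB, h₁, h₂]

end Loss

end DHNN

theorem theorem4p1
    -- mesh and discretization space `V(𝒯_h) = W^{s,p}(𝒯_h)`
    {N : ℕ} (x : Fin (N + 1) → ℝ) (hx : StrictMono x)
    (s : ℕ) (p : ℝ≥0∞) [Fact (1 ≤ p)] (hp : p ≠ ⊤)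
    -- activation function
    (σ : ℝ → ℂ) (hσ_bdd : ∃ K : ℝ, ∀ t, ‖σ t‖ ≤ K)
    (hσ_nonconst : ¬ ∃ c : ℂ, ∀ᵐ t : ℝ, σ t = c)
    -- elementwise smoothness, as far as needed: all networks belong to `V(𝒯_h)` (so if `σ` is `C^s`)
    (hσ_smooth : ∀ (n : ℕ) (Θ : DHNN.Params N n),
      ∃ v : DHNN.brokenSobolev x s p, DHNN.Represents v (DHNN.network σ Θ))
    -- parameter bounds
    (C : ℕ → ℝ) (hC_pos : ∀ n, 0 < C n) (hC_mono : Monotone C) (hC : Tendsto C atTop atTop)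
    -- data spaces, and a complete orthonormal basis `φ k` of each `Y_k`
    {Y Z W : Type*} {Yk : Fin N → Type*}
    [NormedAddCommGroup Y] [InnerProductSpace ℂ Y]
    [∀ k, NormedAddCommGroup (Yk k)] [∀ k, InnerProductSpace ℂ (Yk k)]
    [NormedAddCommGroup Z] [NormedSpace ℂ Z]
    [NormedAddCommGroup W] [NormedSpace ℂ W]
    (restr : Y ≃ₗᵢ[ℂ] PiLp 2 Yk) (φ : ∀ k, HilbertBasis ℕ ℂ (Yk k))
    -- the boundary value problem, assumed to be solvable
    (A : DHNN.brokenSobolev x s p →L[ℂ] Y) (f : Y)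
    (B : DHNN.brokenSobolev x s p →L[ℂ] Z) (g : Z)
    (J₁ J₂ : DHNN.brokenSobolev x s p →L[ℂ] W)
    (hsol : ∃ u : DHNN.brokenSobolev x s p, A u = f ∧ B u = g ∧ J₁ u = 0 ∧ J₂ u = 0)
    (τ : ℝ) (hτ : 0 < τ) (M : Fin N → ℕ) :
    Tendsto (fun n => sInf (DHNN.truncatedLoss restr φ A f B g J₁ J₂ τ M ''
        DHNN.boundedNetworks σ x s p n (C n))) atTop (𝓝 0) ∧
    ∀ u : ℕ → DHNN.brokenSobolev x s p,
      (∀ᶠ n in atTop, u n ∈ DHNN.boundedNetworks σ x s p n (C n) ∧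
        IsMinOn (DHNN.truncatedLoss restr φ A f B g J₁ J₂ τ M)
          (DHNN.boundedNetworks σ x s p n (C n)) (u n)) →
      Tendsto (fun n => DHNN.truncatedLoss restr φ A f B g J₁ J₂ τ M (u n)) atTop (𝓝 0) := by
  obtain ⟨K, hK⟩ := hσ_bdd
  obtain ⟨u₀, hA, hB, h₁, h₂⟩ := hsol
  have h0 := DHNN.truncatedLoss_nonneg restr φ A f B g J₁ J₂ τ M hτ.le
  have hsmall : ∀ ε > 0, ∃ v, DHNN.truncatedLoss restr φ A f B g J₁ J₂ τ M v < ε ∧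
      ∀ᶠ n in atTop, v ∈ DHNN.boundedNetworks σ x s p n (C n) := by
    intro ε hε
    -- The set where the loss is below `ε` is open and contains the solution, so it meets the dense
    -- set of networks.
    obtain ⟨v, hv, hvN⟩ := (DHNN.dense_networks hx hp hK hσ_nonconst hσ_smooth).inter_open_nonempty
      _ ((DHNN.continuous_truncatedLoss restr φ A f B g J₁ J₂ τ M).isOpen_preimage _
        (isOpen_Iio (a := ε)))
      ⟨u₀, by
        rw [mem_preimage, DHNN.truncatedLoss_eq_zero restr φ A f B g J₁ J₂ τ M hA hB h₁ h₂]
        exact hε⟩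
    exact ⟨v, hv, DHNN.eventually_mem_boundedNetworks hC hvN⟩
  constructor
  · refine tendsto_order.2 ⟨fun a ha => Eventually.of_forall fun n => ?_, fun ε hε => ?_⟩
    -- `Real.sInf_nonneg` needs no nonempty set: the infimum of the empty set is `0` by convention.
    · exact ha.trans_le (Real.sInf_nonneg (by rintro _ ⟨v, -, rfl⟩; exact h0 v))
    · obtain ⟨v, hv, hvN⟩ := hsmall ε hε
      filter_upwards [hvN] with n hn
      exact (csInf_le ⟨0, by rintro _ ⟨v, -, rfl⟩; exact h0 v⟩ (mem_image_of_mem _ hn)).trans_lt hv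
  · intro u hu
    refine tendsto_order.2 ⟨fun a ha => Eventually.of_forall fun n => ha.trans_le (h0 _),
      fun ε hε => ?_⟩
    obtain ⟨v, hv, hvN⟩ := hsmall ε hε
    filter_upwards [hvN, hu] with n hn hun
    exact (isMinOn_iff.1 hun.2 v hn).trans_lt hv
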